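/- Let $d\ge 1$, let $c\in C^\infty(\mathbb{R}^d)$ satisfy $0<c_0\le c(x)\le C_0$ for all $x$ with constants $c_0,C_0$, and let $\Phi:\mathbb{R}^d\to\mathbb{R}$ be positively homogeneous of degree $1$ with Wulff set $W\subset\mathbb{R}^d$, that is, $\Phi(p)=\max_{w\in W}\langle p,w\rangle$ for all $p\in\mathbb{R}^d$. Assume that $W$ is closed, strictly convex, balanced ($-W=W$), absorbing (every $y\in\mathbb{R}^d$ lies in $\tau W$ for some $\tau>0$), and has a $C^\infty$ boundary $\partial W$, where strict convexity of the boundary is understood in the differential-geometric sense: the second fundamental form of $\partial W$ is positive definite at every point. Put $H(x,p)=c(x)\Phi(p)$ and $$\tilde d(x,y)=\inf\{t>0:\ \exists\,\gamma\in C^\infty([0,t];\mathbb{R}^d),\ \gamma(0)=x,\ \gamma(t)=y,\ \dot\gamma(s)\in c(\gamma(s))W\ \text{for all } s\in[0,t]\},$$ and assume that $\mathbb{R}^d$ with the metric $\tilde d$ is complete. Let $\partial_p^-H$ denote the Mordukhovich (limiting) subdifferential of $H$ with respect to $p$. For $x\in\mathbb{R}^d$ and $t>0$ define $$C(x,t)=\bigcup_{v\in\mathbb{R}^d}\{\gamma(0):\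 (\gamma,p)\in C^\infty([0,t]),\ \dot\gamma\in\partial_p^-H(\gamma,p),\ \dot p=-\partial_xH(\gamma,p)\ \text{on }[0,t],\ \gamma(t)=x,\ p(t)=v\},$$ $$B(x,t)=\bigcup_{0\le r\le t}\ \bigcup_{v\ne0}\{\gamma(0):\ \dot\gamma=\partial_pH(\gamma,p),\ \dot p=-\partial_xH(\gamma,p)\ \text{on }[0,r],\ \gamma(r)=x,\ p(r)=v\}.$$ Then for all $x\in\mathbb{R}^d$ and $t>0$ the set $B(x,t)$ is well defined, in the sense that for all $0\le r\le t$ and $v\neq0$ the system $\dot\gamma=\partial_pH(\gamma,p)$, $\dot p=-\partial_xH(\gamma,p)$ with $\gamma(r)=x$, $p(r)=v$ has exactly one solution on $[0,r]$ (along which $\partial_pH$ exists), and $$C(x,t)=B(x,t).$$ -/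

import Mathlib

open Set Filter Topology
open scoped ContDiff Pointwise

namespace HJ

/-- The state space `ℝᵈ` with its Euclidean norm and inner product. -/
abbrev E (d : ℕ) : Type := EuclideanSpace ℝ (Fin d)

/-! ### Geometry of the Wulff set -/

/-- `W` is the Wulff set of `Φ`: `Φ p = max_{w ∈ W} ⟨p, w⟩` for every `p`, the maximum being
attained. -/
def IsWulffSet {d : ℕ} (Φ : E d → ℝ) (W : Set (E d)) : Prop :=
  ∀ p : E d, IsGreatest ((fun w : E d => inner ℝ p w) '' W) (Φ p)

/-- `f` is a smooth defining function of `W` on the open neighbourhood `U` of the boundary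
point `z`. -/
def IsLocalDefiningFunction {d : ℕ} (W U : Set (E d)) (f : E d → ℝ) (z : E d) : Prop :=
  IsOpen U ∧ z ∈ U ∧ ContDiffOn ℝ ∞ f U ∧ W ∩ U = {y ∈ U | f y ≤ 0} ∧ fderiv ℝ f z ≠ 0

/-- The boundary of `W` is a `C^∞` hypersurface, with `W` locally on one side of it, and its second
fundamental form is positive definite at every point: the second derivative of a local defining
function is positive on nonzero tangent vectors. (Positivity does not depend on the defining
function.) -/
def HasSmoothPositivelyCurvedBoundary {d : ℕ} (W : Set (E d)) : Prop :=
  ∀ z ∈ frontier W, ∃ (U : Set (E d)) (f : E d → ℝ), IsLocalDefiningFunction W U f z ∧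
    ∀ v : E d, v ≠ 0 → fderiv ℝ f z v = 0 → 0 < fderiv ℝ (fderiv ℝ f) z v v

/-- Every point of the space lies in some positive dilate of `W`. -/
def IsAbsorbing {d : ℕ} (W : Set (E d)) : Prop :=
  ∀ y : E d, ∃ τ : ℝ, 0 < τ ∧ y ∈ τ • W

/-! ### The optical distance -/

/-- The optical distance: the infimum of the times `t > 0` in which a `C^∞` curve
`γ : [0,t] → ℝᵈ` with `γ̇(s) ∈ c(γ(s)) W` leads from `x` to `y`. -/
noncomputable def opticalDist {d : ℕ} (c : E d → ℝ) (W : Set (E d)) (x y : E d) : ℝ :=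
  sInf {t : ℝ | 0 < t ∧ ∃ γ : ℝ → E d, ContDiffOn ℝ ∞ γ (Icc 0 t) ∧ γ 0 = x ∧ γ t = y ∧
    ∀ s ∈ Icc 0 t, ∃ g ∈ c (γ s) • W, HasDerivWithinAt γ g (Icc 0 t) s}

/-- Completeness of a distance function: every Cauchy sequence converges. -/
def IsCompleteDist {X : Type*} (δ : X → X → ℝ) : Prop :=
  ∀ u : ℕ → X, (∀ ε > 0, ∃ N : ℕ, ∀ m ≥ N, ∀ n ≥ N, δ (u m) (u n) < ε) →
    ∃ l : X, Tendsto (fun n => δ (u n) l) atTop (𝓝 0)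

/-! ### Subdifferentials -/

/-- The Fréchet subdifferential of `f` at `p`: all `ξ` with
`liminf_{q → p} (f q - f p - ⟨ξ, q - p⟩) / ‖q - p‖ ≥ 0`. -/
def frechetSubdifferential {d : ℕ} (f : E d → ℝ) (p : E d) : Set (E d) :=
  {ξ | ∀ ε > 0, ∀ᶠ q in 𝓝 p, -ε * ‖q - p‖ ≤ f q - f p - inner ℝ ξ (q - p)}

/-- The Mordukhovich (limiting) subdifferential of `f` at `p`. -/
def mordukhovichSubdifferential {d : ℕ} (f : E d → ℝ) (p : E d) : Set (E d) :=
  {ξ | ∃ (q η : ℕ → E d), Tendsto q atTop (𝓝 p) ∧ Tendsto (fun n => f (q n)) atTop (𝓝 (f p)) ∧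
    (∀ n, η n ∈ frechetSubdifferential f (q n)) ∧ Tendsto η atTop (𝓝 ξ)}

/-! ### The bicharacteristic systems -/

/-- The Hamiltonian `H(x,p) = c(x) Φ(p)`. -/
def hamiltonian {d : ℕ} (c Φ : E d → ℝ) (x p : E d) : ℝ := c x * Φ p

/-- `(γ, p)` solves `γ̇ = ∂ₚH(γ,p)`, `ṗ = -∂ₓH(γ,p)` on `[0,r]`; in particular `H` is required to
have both partial gradients along the curve. Only the values on `[0,r]` matter. -/
def IsBicharacteristic {d : ℕ} (H : E d → E d → ℝ) (r : ℝ) (γ p : ℝ → E d) : Prop :=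
  ∀ s ∈ Icc 0 r, ∃ a b : E d,
    HasGradientAt (fun q => H (γ s) q) a (p s) ∧ HasGradientAt (fun y => H y (p s)) b (γ s) ∧
    HasDerivWithinAt γ a (Icc 0 r) s ∧ HasDerivWithinAt p (-b) (Icc 0 r) s

/-- `(γ, p)` solves `γ̇ ∈ ∂ₚ⁻H(γ,p)`, `ṗ = -∂ₓH(γ,p)` on `[0,t]`, where `∂ₚ⁻` is the Mordukhovich
subdifferential. -/
def IsGeneralizedBicharacteristic {d : ℕ} (H : E d → E d → ℝ) (t : ℝ) (γ p : ℝ → E d) : Prop :=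
  ∀ s ∈ Icc 0 t, ∃ a b : E d,
    a ∈ mordukhovichSubdifferential (fun q => H (γ s) q) (p s) ∧
    HasGradientAt (fun y => H y (p s)) b (γ s) ∧
    HasDerivWithinAt γ a (Icc 0 t) s ∧ HasDerivWithinAt p (-b) (Icc 0 t) s

/-- The set `C(x,t)` of initial points `γ(0)` of smooth solutions of the inclusion system on `[0,t]`
with `γ(t) = x`, `p(t) = v`, over all `v`. -/
def setC {d : ℕ} (H : E d → E d → ℝ) (x : E d) (t : ℝ) : Set (E d) :=
  ⋃ v : E d, {y | ∃ γ p : ℝ → E d, ContDiffOn ℝ ∞ γ (Icc 0 t) ∧ ContDiffOn ℝ ∞ p (Icc 0 t) ∧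
    IsGeneralizedBicharacteristic H t γ p ∧ γ t = x ∧ p t = v ∧ γ 0 = y}

/-- The set `B(x,t)` of initial points `γ(0)` of bicharacteristics on `[0,r]` with `γ(r) = x`,
`p(r) = v`, over all `0 ≤ r ≤ t` and all `v ≠ 0`. -/
def setB {d : ℕ} (H : E d → E d → ℝ) (x : E d) (t : ℝ) : Set (E d) :=
  ⋃ r ∈ Icc 0 t, ⋃ v ∈ {v : E d | v ≠ 0}, {y | ∃ γ p : ℝ → E d,
    IsBicharacteristic H r γ p ∧ γ r = x ∧ p r = v ∧ γ 0 = y}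

/-- `B(x,t)` is well defined: for all `0 ≤ r ≤ t` and `v ≠ 0` the bicharacteristic with
`γ(r) = x`, `p(r) = v` exists on all of `[0,r]` and is unique there. -/
def SetBWellDefined {d : ℕ} (H : E d → E d → ℝ) (x : E d) (t : ℝ) : Prop :=
  ∀ r ∈ Icc 0 t, ∀ v : E d, v ≠ 0 →
    (∃ γ p : ℝ → E d, IsBicharacteristic H r γ p ∧ γ r = x ∧ p r = v) ∧
    ∀ γ₁ p₁ γ₂ p₂ : ℝ → E d,
      IsBicharacteristic H r γ₁ p₁ → γ₁ r = x → p₁ r = v →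
      IsBicharacteristic H r γ₂ p₂ → γ₂ r = x → p₂ r = v →
      EqOn γ₁ γ₂ (Icc 0 r) ∧ EqOn p₁ p₂ (Icc 0 r)

end HJ

/-!
Both `setC` and `setB` turn out to be the set of points from which `x` is reached in time `t` by a
curve with velocity in `c(γ) W`.

*Geometry.* `Φ` is a norm with dual norm `gauge W`. Positivity of the second fundamental form makes
the Gauss map of the boundary a local diffeomorphism, so `Φ` is smooth off the origin
(`IsWulffBody.exists_contDiffAt_maximiser`) and `∇Φ` takes values in `W`. Since the boundary has
unique, continuously varying normals, `gauge W ^ 2 / 2` is differentiable, with gradient the inverse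
of the Legendre map `p ↦ Φ(p) ∇Φ(p)` (`IsWulffBody.exists_hasGradientAt_half_sq_gauge`).

*The flow.* The Hamiltonian `c² Φ² / 2` has a locally Lipschitz vector field, also across `p = 0`, and
it conserves `c Φ`. With the bounds on `c` this confines trajectories and makes them global. On
nonzero momenta the bicharacteristics of `c Φ` are exactly its trajectories, with time multiplied by
the conserved value of `c Φ`. This gives existence, uniqueness and smoothness of bicharacteristics.

*`setB ⊆ setC`.* A bicharacteristic of length `r ≤ t`, slowed down to last the time `t`, still has
velocity in `c(γ) W`, which is the limiting subdifferential of `c Φ` at `p = 0`; so it solves the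
inclusion system with vanishing momentum.

*`setC ⊆ setB`.* Limiting subgradients of `c Φ` always lie in `c W`, so what is needed is a theorem of
Hopf–Rinow type (`IsAdmissible.exists_isSolution`): the endpoints of an admissible curve are joined by
a trajectory of `c² Φ² / 2` with `c Φ ≤ 1`. Sample the curve in `N` steps and minimise the discrete
action over all polygons with the same endpoints. The Euler–Lagrange equations of a minimiser are the
symplectic Euler scheme of the flow (`exists_symplecticEuler`). The action bounds positions and
momenta uniformly in `N`, so along a subsequence the initial momenta converge, and by a discrete
Grönwall estimate the polygons converge to an exact trajectory with the right endpoints. Its energy is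
at most one because the discrete mean energies are at most one up to `o(1)`.
-/

namespace HJ

variable {d : ℕ} {c Φ : E d → ℝ} {W : Set (E d)}

/-- The standing hypotheses on the pair `(Φ, W)`: `W` is a closed convex symmetric absorbing set with
smooth positively curved boundary, and `Φ` is its support function. -/
structure IsWulffBody (Φ : E d → ℝ) (W : Set (E d)) : Prop where
  wulff : IsWulffSet Φ W
  closed : IsClosed W
  convex : Convex ℝ W
  balanced : -W = W
  absorbing : IsAbsorbing W
  smooth : HasSmoothPositivelyCurvedBoundary W

/-! ### The support function is a norm -/

namespace IsWulffBody

theorem inner_le (h : IsWulffBody Φ W) (p : E d) {w : E d} (hw : w ∈ W) : inner ℝ p w ≤ Φ p :=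
  (h.wulff p).2 ⟨w, hw, rfl⟩

theorem exists_inner_eq (h : IsWulffBody Φ W) (p : E d) : ∃ w ∈ W, inner ℝ p w = Φ p :=
  (h.wulff p).1

theorem neg_mem (h : IsWulffBody Φ W) {w : E d} (hw : w ∈ W) : -w ∈ W := by
  rw [← h.balanced]; simpa using hw

theorem zero_mem (h : IsWulffBody Φ W) : (0 : E d) ∈ W := by
  obtain ⟨w, hw, -⟩ := h.exists_inner_eq 0
  have := h.convex hw (h.neg_mem hw) (a := 1 / 2) (b := 1 / 2) (by norm_num) (by norm_num)
    (by norm_num)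
  simpa using this

theorem apply_nonneg (h : IsWulffBody Φ W) (p : E d) : 0 ≤ Φ p := by
  simpa using h.inner_le p h.zero_mem

theorem apply_smul (h : IsWulffBody Φ W) {τ : ℝ} (hτ : 0 ≤ τ) (p : E d) : Φ (τ • p) = τ * Φ p := by
  apply le_antisymm
  · obtain ⟨w, hw, hwp⟩ := h.exists_inner_eq (τ • p)
    rw [← hwp, real_inner_smul_left]
    exact mul_le_mul_of_nonneg_left (h.inner_le p hw) hτ
  · obtain ⟨w, hw, hwp⟩ := h.exists_inner_eq p
    rw [← hwp, ← real_inner_smul_left]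
    exact h.inner_le _ hw

theorem apply_zero (h : IsWulffBody Φ W) : Φ 0 = 0 := by
  simpa using h.apply_smul le_rfl 0

theorem apply_neg (h : IsWulffBody Φ W) (p : E d) : Φ (-p) = Φ p := by
  have key : ∀ q : E d, Φ (-q) ≤ Φ q := fun q => by
    obtain ⟨w, hw, hwp⟩ := h.exists_inner_eq (-q)
    rw [← hwp, inner_neg_left, ← inner_neg_right]
    exact h.inner_le q (h.neg_mem hw)
  exact le_antisymm (key p) (by simpa using key (-p))

theorem apply_add_le (h : IsWulffBody Φ W) (p q : E d) : Φ (p + q) ≤ Φ p + Φ q := by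
  obtain ⟨w, hw, hwp⟩ := h.exists_inner_eq (p + q)
  rw [← hwp, inner_add_left]
  exact add_le_add (h.inner_le p hw) (h.inner_le q hw)

theorem apply_pos (h : IsWulffBody Φ W) {p : E d} (hp : p ≠ 0) : 0 < Φ p := by
  obtain ⟨τ, hτ, w, hw, rfl⟩ := h.absorbing p
  simp only at hp ⊢
  have hw0 : w ≠ 0 := by rintro rfl; simp at hp
  have h1 := h.inner_le (τ • w) hw
  have h2 : 0 < inner ℝ (τ • w) w := by
    rw [real_inner_smul_left]
    exact mul_pos hτ (real_inner_self_pos.2 hw0)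
  linarith

theorem apply_eq_zero (h : IsWulffBody Φ W) {p : E d} : Φ p = 0 ↔ p = 0 :=
  ⟨fun hp => by_contra fun h0 => (h.apply_pos h0).ne' hp, fun hp => hp ▸ h.apply_zero⟩

theorem convexOn (h : IsWulffBody Φ W) : ConvexOn ℝ univ Φ := by
  refine ⟨convex_univ, fun p _ q _ a b ha hb _ => ?_⟩
  simpa [h.apply_smul ha, h.apply_smul hb] using h.apply_add_le (a • p) (b • q)

theorem continuous (h : IsWulffBody Φ W) : Continuous Φ := h.convexOn.locallyLipschitz.continuous

theorem exists_bounds (h : IsWulffBody Φ W) :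
    ∃ m M : ℝ, 0 < m ∧ 0 < M ∧ ∀ p, m * ‖p‖ ≤ Φ p ∧ Φ p ≤ M * ‖p‖ := by
  have hcomp : IsCompact (Metric.sphere (0 : E d) 1) := isCompact_sphere 0 1
  rcases (Metric.sphere (0 : E d) 1).eq_empty_or_nonempty with he | hne
  · refine ⟨1, 1, one_pos, one_pos, fun p => ?_⟩
    have hp : p = 0 := by
      by_contra hp
      have : ‖p‖⁻¹ • p ∈ Metric.sphere (0 : E d) 1 := by
        simp [norm_smul, hp]
      simp [he] at this
    simp [hp, h.apply_zero]
  · obtain ⟨a, ha, hamin⟩ := hcomp.exists_isMinOn hne h.continuous.continuousOn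
    obtain ⟨b, hb, hbmax⟩ := hcomp.exists_isMaxOn hne h.continuous.continuousOn
    have hnz : ∀ z ∈ Metric.sphere (0 : E d) 1, z ≠ 0 := fun z hz h0 => by simp [h0] at hz
    refine ⟨Φ a, Φ b, h.apply_pos (hnz a ha), h.apply_pos (hnz b hb), fun p => ?_⟩
    by_cases hp : p = 0
    · simp [hp, h.apply_zero]
    have hn : 0 < ‖p‖ := norm_pos_iff.2 hp
    have hs : ‖p‖⁻¹ • p ∈ Metric.sphere (0 : E d) 1 := by simp [norm_smul, hp]
    have h1 := hamin hs
    have h2 := hbmax hs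
    simp only [mem_ofPred_eq, h.apply_smul (inv_nonneg.2 hn.le)] at h1 h2
    constructor
    · calc Φ a * ‖p‖ ≤ ‖p‖⁻¹ * Φ p * ‖p‖ := by gcongr
        _ = Φ p := by field_simp
    · calc Φ p = ‖p‖⁻¹ * Φ p * ‖p‖ := by field_simp
        _ ≤ _ := by gcongr

theorem exists_norm_le (h : IsWulffBody Φ W) : ∃ ρ : ℝ, 0 < ρ ∧ ∀ w ∈ W, ‖w‖ ≤ ρ := by
  obtain ⟨m, M, hm, hM, hb⟩ := h.exists_bounds
  refine ⟨M, hM, fun w hw => ?_⟩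
  have h1 := (h.inner_le w hw).trans (hb w).2
  rw [real_inner_self_eq_norm_sq] at h1
  by_contra hc
  push Not at hc
  nlinarith [norm_nonneg w]

/-- A closed convex set is the intersection of its supporting half-spaces. -/
theorem mem_of_forall_inner_le (h : IsWulffBody Φ W) {u : E d} (hu : ∀ q, inner ℝ q u ≤ Φ q) :
    u ∈ W := by
  by_contra hn
  obtain ⟨f, a, hfa, hfu⟩ := geometric_hahn_banach_closed_point h.convex h.closed hn
  set q := (InnerProductSpace.toDual ℝ (E d)).symm f with hq
  have hqf : ∀ v, inner ℝ q v = f v := fun v => by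
    rw [hq, InnerProductSpace.toDual_symm_apply]
  obtain ⟨w, hw, hwq⟩ := h.exists_inner_eq q
  have := hu q
  rw [← hwq, hqf, hqf] at this
  linarith [hfa w hw]

theorem mem_nhds_zero (h : IsWulffBody Φ W) : W ∈ 𝓝 (0 : E d) := by
  obtain ⟨m, M, hm, hM, hb⟩ := h.exists_bounds
  refine mem_of_superset (Metric.closedBall_mem_nhds 0 hm) fun u hu =>
    h.mem_of_forall_inner_le fun q => (real_inner_le_norm q u).trans ?_
  rw [mem_closedBall_zero_iff] at hu
  calc ‖q‖ * ‖u‖ ≤ ‖q‖ * m := by gcongr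
    _ = m * ‖q‖ := mul_comm _ _
    _ ≤ Φ q := (hb q).1

/-! ### The gauge -/

theorem absorbent (h : IsWulffBody Φ W) : Absorbent ℝ W := absorbent_nhds_zero h.mem_nhds_zero

theorem continuous_gauge (h : IsWulffBody Φ W) : Continuous (gauge W) :=
  _root_.continuous_gauge h.convex h.mem_nhds_zero

theorem gauge_pos (h : IsWulffBody Φ W) {u : E d} (hu : u ≠ 0) : 0 < gauge W u := by
  obtain ⟨ρ, -, hW⟩ := h.exists_norm_le
  refine (_root_.gauge_pos h.absorbent ?_).2 hu
  exact (NormedSpace.isVonNBounded_iff ℝ).2 (isBounded_iff_forall_norm_le.2 ⟨ρ, hW⟩)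

theorem gauge_le_of_forall_inner_le (h : IsWulffBody Φ W) {u : E d} {τ : ℝ} (hτ : 0 < τ)
    (hu : ∀ q, inner ℝ q u ≤ τ * Φ q) : gauge W u ≤ τ := by
  refine gauge_le_of_mem hτ.le ⟨τ⁻¹ • u, h.mem_of_forall_inner_le fun q => ?_, by
    simp [smul_smul, hτ.ne']⟩
  rw [real_inner_smul_right, inv_mul_le_iff₀ hτ]
  exact hu q

theorem inv_gauge_smul_mem_frontier (h : IsWulffBody Φ W) {u : E d} (hu : u ≠ 0) :
    (gauge W u)⁻¹ • u ∈ frontier W := by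
  rw [← gauge_eq_one_iff_mem_frontier h.convex h.mem_nhds_zero,
    gauge_smul_of_nonneg (inv_nonneg.2 (h.gauge_pos hu).le), smul_eq_mul,
    inv_mul_cancel₀ (h.gauge_pos hu).ne']

theorem frontier_subset (h : IsWulffBody Φ W) : frontier W ⊆ W :=
  h.closed.frontier_subset

/-- The Cauchy–Schwarz inequality for the dual pair of norms `Φ`, `gauge W`. -/
theorem inner_le_mul_gauge (h : IsWulffBody Φ W) (q u : E d) : inner ℝ q u ≤ Φ q * gauge W u := by
  by_cases hu : u = 0
  · simp [hu]
  have h1 := h.inner_le q (h.frontier_subset (h.inv_gauge_smul_mem_frontier hu))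
  rw [real_inner_smul_right, inv_mul_le_iff₀ (h.gauge_pos hu)] at h1
  linarith

theorem norm_le_mul_gauge (h : IsWulffBody Φ W) {ρ : ℝ} (hρ : ∀ w ∈ W, ‖w‖ ≤ ρ) (u : E d) :
    ‖u‖ ≤ ρ * gauge W u := by
  by_cases hu : u = 0
  · simp [hu]
  have h1 := hρ _ (h.frontier_subset (h.inv_gauge_smul_mem_frontier hu))
  have hpos := h.gauge_pos hu
  rw [norm_smul, norm_inv, Real.norm_of_nonneg hpos.le, inv_mul_le_iff₀ hpos] at h1
  linarith

end IsWulffBody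

/-! ### Normals of the boundary -/

/-- A defining function increases to first order only along outward directions: its differential
supports the convex set `W`. -/
theorem fderiv_sub_nonpos {U : Set (E d)} {f : E d → ℝ} {z w : E d} (hconv : Convex ℝ W)
    (hU : IsOpen U) (hz : z ∈ U) (hWU : W ∩ U = {y ∈ U | f y ≤ 0}) (hfz : f z = 0)
    (hd : DifferentiableAt ℝ f z) (hw : w ∈ W) : fderiv ℝ f z (w - z) ≤ 0 := by
  have hzW : z ∈ W := by
    have : z ∈ W ∩ U := hWU ▸ ⟨hz, hfz.le⟩
    exact this.1
  have hmax : IsLocalMaxOn f W z := by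
    filter_upwards [self_mem_nhdsWithin, mem_nhdsWithin_of_mem_nhds (hU.mem_nhds hz)] with y hy hyU
    have : y ∈ {y ∈ U | f y ≤ 0} := hWU ▸ ⟨hy, hyU⟩
    rw [hfz]
    exact this.2
  exact hmax.hasFDerivWithinAt_nonpos hd.hasFDerivAt.hasFDerivWithinAt
    (sub_mem_posTangentConeAt_of_segment_subset (hconv.segment_subset hzW hw))

theorem IsLocalDefiningFunction.eq_zero {U : Set (E d)} {f : E d → ℝ} {z y : E d}
    (hf : IsLocalDefiningFunction W U f z) (hy : y ∈ frontier W) (hyW : y ∈ W) (hyU : y ∈ U) :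
    f y = 0 := by
  obtain ⟨hU, hz, hsm, hWU, -⟩ := hf
  have h1 : y ∈ {y ∈ U | f y ≤ 0} := hWU ▸ ⟨hyW, hyU⟩
  refine le_antisymm h1.2 (not_lt.1 fun hlt => ?_)
  have hc : ContinuousAt f y := hsm.continuousOn.continuousAt (hU.mem_nhds hyU)
  have h2 : W ∈ 𝓝 y := by
    filter_upwards [hc.eventually (gt_mem_nhds hlt), hU.mem_nhds hyU] with x hx hxU
    have : x ∈ W ∩ U := hWU ▸ ⟨hxU, le_of_lt hx⟩
    exact this.1
  exact hy.2 (mem_interior_iff_mem_nhds.2 h2)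

theorem IsLocalDefiningFunction.contDiffAt {U : Set (E d)} {f : E d → ℝ} {z y : E d}
    (hf : IsLocalDefiningFunction W U f z) (hyU : y ∈ U) : ContDiffAt ℝ ∞ f y :=
  hf.2.2.1.contDiffAt (hf.1.mem_nhds hyU)

/-- The normal cone of `W` at a boundary point is the ray spanned by the differential of a defining
function. -/
theorem IsLocalDefiningFunction.exists_inner_eq_smul {U : Set (E d)} {f : E d → ℝ} {z p : E d}
    (hf : IsLocalDefiningFunction W U f z) (hfz : f z = 0)
    (hp : ∀ w ∈ W, inner ℝ p w ≤ inner ℝ p z) :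
    ∃ l : ℝ, 0 ≤ l ∧ innerSL ℝ p = l • fderiv ℝ f z := by
  have hd : DifferentiableAt ℝ f z := (hf.contDiffAt hf.2.1).differentiableAt (by simp)
  obtain ⟨hU, hz, hsm, hWU, hne⟩ := hf
  have key : ∀ v, fderiv ℝ f z v < 0 → inner ℝ p v ≤ 0 := fun v hv => by
    have hline : HasDerivAt (fun s : ℝ => f (z + s • v)) (fderiv ℝ f z v) 0 := by
      have h0 : HasFDerivAt f (fderiv ℝ f z) (z + (0 : ℝ) • v) := by simpa using hd.hasFDerivAt
      refine h0.comp_hasDerivAt (0 : ℝ) ?_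
      simpa using ((hasDerivAt_id (0 : ℝ)).smul_const v).const_add z
    have hev : ∀ᶠ s : ℝ in 𝓝[>] 0, f (z + s • v) < 0 := by
      have h1 := hline.hasDerivWithinAt (s := Ioi 0)
      rw [hasDerivWithinAt_iff_tendsto_slope' (by simp)] at h1
      filter_upwards [h1.eventually (gt_mem_nhds hv), self_mem_nhdsWithin] with s hs hs0
      rw [slope_def_field] at hs
      simp only [zero_smul, add_zero, hfz, sub_zero] at hs
      rcases div_neg_iff.1 hs with h2 | h2
      · exact absurd h2.2 (not_lt.2 (le_of_lt hs0))
      · exact h2.1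
    have hevU : ∀ᶠ s : ℝ in 𝓝[>] 0, z + s • v ∈ U := by
      have : ContinuousAt (fun s : ℝ => z + s • v) 0 := by fun_prop
      exact (this.eventually_mem (by simpa using hU.mem_nhds hz)).filter_mono nhdsWithin_le_nhds
    obtain ⟨s, ⟨hs1, hs2⟩, hs0⟩ := ((hev.and hevU).and self_mem_nhdsWithin).exists
    have hsW : z + s • v ∈ W ∩ U := hWU ▸ ⟨hs2, hs1.le⟩
    have := hp _ hsW.1
    rw [inner_add_right, real_inner_smul_right] at this
    have h3 : s * inner ℝ p v ≤ 0 := by linarith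
    exact nonpos_of_mul_nonpos_right h3 hs0
  set n := (InnerProductSpace.toDual ℝ (E d)).symm (fderiv ℝ f z) with hn
  have hnf : ∀ v, inner ℝ n v = fderiv ℝ f z v := fun v => by
    rw [hn, InnerProductSpace.toDual_symm_apply]
  have hn0 : n ≠ 0 := by simpa [hn] using hne
  have hnn : 0 < inner ℝ n n := real_inner_self_pos.2 hn0
  have hpn : 0 ≤ inner ℝ p n := by
    have := key (-n) (by rw [← hnf, inner_neg_right]; linarith)
    rw [inner_neg_right] at this
    linarith
  have hperp : ∀ v, inner ℝ n v = 0 → inner ℝ p v ≤ 0 := fun v hv => by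
    by_contra! hpos
    -- tilt `v` slightly inwards, so little that the pairing with `p` stays positive
    have hε : 0 < inner ℝ p v / (inner ℝ p n + 1) := by positivity
    have := key (v - (inner ℝ p v / (inner ℝ p n + 1)) • n) (by
      rw [← hnf, inner_sub_right, hv, real_inner_smul_right]
      have := mul_pos hε hnn
      linarith)
    rw [inner_sub_right, real_inner_smul_right, div_mul_eq_mul_div, sub_nonpos,
      le_div_iff₀ (by positivity)] at this
    nlinarith
  refine ⟨inner ℝ p n / inner ℝ n n, by positivity, ?_⟩
  set l := inner ℝ p n / inner ℝ n n with hl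
  have h1 : inner ℝ n (p - l • n) = 0 := by
    rw [inner_sub_right, real_inner_smul_right, hl, div_mul_cancel₀ _ hnn.ne', real_inner_comm,
      sub_self]
  have h2 := hperp _ h1
  have h3 : inner ℝ (p - l • n) (p - l • n) ≤ 0 := by
    rw [inner_sub_left (x := p), real_inner_smul_left, h1]
    linarith
  have h4 : p = l • n := sub_eq_zero.1
    (inner_self_eq_zero.1 (le_antisymm h3 real_inner_self_nonneg))
  ext v
  rw [innerSL_apply_apply, smul_apply, ← hnf, smul_eq_mul,
    ← real_inner_smul_left, ← h4]

/-! ### Smoothness of the support function -/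

namespace IsWulffBody

/-- If `Φ` is differentiable at `p`, a maximiser of `⟨p, ·⟩` over `W` is the gradient of `Φ`. -/
theorem hasGradientAt_of_inner_eq (h : IsWulffBody Φ W) {p w : E d} (hd : DifferentiableAt ℝ Φ p)
    (hw : w ∈ W) (hwp : inner ℝ p w = Φ p) : HasGradientAt Φ w p := by
  have h1 : HasFDerivAt (fun q => Φ q - innerSL ℝ w q) (fderiv ℝ Φ p - innerSL ℝ w) p :=
    hd.hasFDerivAt.sub (innerSL ℝ w).hasFDerivAt
  have hmin : IsLocalMin (fun q => Φ q - innerSL ℝ w q) p := by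
    refine Eventually.of_forall fun q => ?_
    simp only [innerSL_apply_apply]
    rw [real_inner_comm, hwp, sub_self, sub_nonneg, real_inner_comm]
    exact h.inner_le q hw
  have h2 := sub_eq_zero.1 (hmin.hasFDerivAt_eq_zero h1)
  rw [hasGradientAt_iff_hasFDerivAt]
  have h3 : (InnerProductSpace.toDual ℝ (E d)) w = fderiv ℝ Φ p := by
    rw [h2]; rfl
  rw [h3]
  exact hd.hasFDerivAt

/-- The Gauss map of the boundary is invertible: near each nonzero covector the maximiser over `W`
can be chosen to depend smoothly on the covector. The equations `l ∇f(z) = p`, `f(z) = 0` are solved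
by the inverse function theorem, whose hypothesis is the positivity of the second fundamental
form. -/
theorem exists_contDiffAt_maximiser (h : IsWulffBody Φ W) {p₀ : E d} (hp₀ : p₀ ≠ 0) :
    ∃ Z : E d → E d, ContDiffAt ℝ ∞ Z p₀ ∧ ∀ᶠ p in 𝓝 p₀, Z p ∈ W ∧ inner ℝ p (Z p) = Φ p := by
  obtain ⟨z, hzW, hzp⟩ := h.exists_inner_eq p₀
  have hzmax : ∀ w ∈ W, inner ℝ p₀ w ≤ inner ℝ p₀ z := fun w hw => hzp ▸ h.inner_le p₀ hw
  have hzfr : z ∈ frontier W := by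
    refine ⟨subset_closure hzW, fun hint => ?_⟩
    have hmax : IsLocalMax (innerSL ℝ p₀) z := by
      filter_upwards [mem_interior_iff_mem_nhds.1 hint] with w hw
      exact hzmax w hw
    have h0 := hmax.hasFDerivAt_eq_zero (innerSL ℝ p₀).hasFDerivAt
    have := DFunLike.congr_fun h0 p₀
    rw [innerSL_apply_apply] at this
    exact hp₀ (inner_self_eq_zero.1 this)
  obtain ⟨U, f, hf, hcurv⟩ := h.smooth z hzfr
  have hfz := hf.eq_zero hzfr hzW hf.2.1
  obtain ⟨l, hl, hpl⟩ := hf.exists_inner_eq_smul hfz hzmax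
  have hl0 : 0 < l := by
    refine hl.lt_of_ne fun h0 => hp₀ ?_
    rw [← h0, zero_smul] at hpl
    have := DFunLike.congr_fun hpl p₀
    rw [innerSL_apply_apply] at this
    exact inner_self_eq_zero.1 this
  have hfs : ContDiffAt ℝ ∞ f z := hf.contDiffAt hf.2.1
  have hdfs : ContDiffAt ℝ ∞ (fderiv ℝ f) z :=
    ContDiffAt.fderiv_right hfs (m := ∞) (by simp)
  let Ψ : E d × ℝ → (E d →L[ℝ] ℝ) × ℝ := fun x => (x.2 • fderiv ℝ f x.1, f x.1)
  have hΨ : ContDiffAt ℝ ∞ Ψ (z, l) := by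
    have h1 : ContDiffAt ℝ ∞ (fun x : E d × ℝ => fderiv ℝ f x.1) (z, l) :=
      ContDiffAt.comp (z, l) (g := fderiv ℝ f) hdfs contDiffAt_fst
    have h2 : ContDiffAt ℝ ∞ (fun x : E d × ℝ => f x.1) (z, l) :=
      ContDiffAt.comp (z, l) (g := f) hfs contDiffAt_fst
    exact (contDiffAt_snd.smul h1).prodMk h2
  let D2 := fderiv ℝ (fderiv ℝ f) z
  let D1 := fderiv ℝ f z
  let L : E d × ℝ →L[ℝ] (E d →L[ℝ] ℝ) × ℝ :=
    (l • D2.comp (ContinuousLinearMap.fst ℝ (E d) ℝ) +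
      (ContinuousLinearMap.snd ℝ (E d) ℝ).smulRight D1).prod
      (D1.comp (ContinuousLinearMap.fst ℝ (E d) ℝ))
  have hL : HasFDerivAt Ψ L (z, l) := by
    have h1 : HasFDerivAt (fun x : E d × ℝ => fderiv ℝ f x.1)
        (D2.comp (ContinuousLinearMap.fst ℝ (E d) ℝ)) (z, l) :=
      HasFDerivAt.comp (z, l) (g := fderiv ℝ f) (hdfs.differentiableAt (by simp)).hasFDerivAt
        hasFDerivAt_fst
    have h2 : HasFDerivAt (fun x : E d × ℝ => f x.1)
        (D1.comp (ContinuousLinearMap.fst ℝ (E d) ℝ)) (z, l) :=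
      HasFDerivAt.comp (z, l) (g := f) (hfs.differentiableAt (by simp)).hasFDerivAt hasFDerivAt_fst
    exact (hasFDerivAt_snd.smul h1).prodMk h2
  have hLapply : ∀ v μ, L (v, μ) = (l • D2 v + μ • D1, D1 v) := fun v μ => rfl
  have hinj : Function.Injective L := by
    rw [injective_iff_map_eq_zero]
    rintro ⟨v, μ⟩ hv
    rw [hLapply, Prod.mk_eq_zero] at hv
    have hv0 : v = 0 := by
      by_contra hne
      have h1 := hcurv v hne hv.2
      have h2 := DFunLike.congr_fun hv.1 v
      simp only [add_apply, smul_apply, smul_eq_mul, hv.2, mul_zero, add_zero,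
        zero_apply] at h2
      exact (mul_pos hl0 h1).ne' h2
    have hμ : μ • D1 = 0 := by simpa [hv0] using hv.1
    rcases smul_eq_zero.1 hμ with h1 | h1
    · simp [hv0, h1]
    · exact absurd h1 hf.2.2.2.2
  have hdim : Module.finrank ℝ (E d × ℝ) = Module.finrank ℝ ((E d →L[ℝ] ℝ) × ℝ) := by
    rw [Module.finrank_prod, Module.finrank_prod,
      ← (LinearMap.toContinuousLinearMap (𝕜 := ℝ) (E := E d) (F' := ℝ)).finrank_eq]
    congr 1
    exact (Subspace.dual_finrank_eq (K := ℝ) (V := E d)).symm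
  let e : (E d × ℝ) ≃L[ℝ] (E d →L[ℝ] ℝ) × ℝ :=
    (LinearMap.linearEquivOfInjective (L : E d × ℝ →ₗ[ℝ] (E d →L[ℝ] ℝ) × ℝ) hinj
      hdim).toContinuousLinearEquiv
  have he : HasFDerivAt Ψ (e : E d × ℝ →L[ℝ] (E d →L[ℝ] ℝ) × ℝ) (z, l) := by
    convert! hL
  let inv := hΨ.localInverse he (by simp)
  have hΨz : Ψ (z, l) = (innerSL ℝ p₀, 0) := by
    simp only [Ψ, hfz, hpl]
  have hinv : ContDiffAt ℝ ∞ inv (innerSL ℝ p₀, 0) := hΨz ▸ hΨ.to_localInverse he (by simp)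
  have hinvz : inv (innerSL ℝ p₀, 0) = (z, l) := hΨz ▸ hΨ.localInverse_apply_image he (by simp)
  have hright : ∀ᶠ y in 𝓝 ((innerSL ℝ p₀ : E d →L[ℝ] ℝ), (0 : ℝ)), Ψ (inv y) = y := by
    rw [← hΨz]
    exact (hΨ.hasStrictFDerivAt' he (by simp)).eventually_right_inverse
  let J : E d → (E d →L[ℝ] ℝ) × ℝ := fun p => (innerSL ℝ p, 0)
  have hJ : ContDiff ℝ ∞ J := (innerSL ℝ (E := E d)).contDiff.prodMk contDiff_const
  have hcomp : ContDiffAt ℝ ∞ (fun p => inv (J p)) p₀ := ContDiffAt.comp p₀ hinv hJ.contDiffAt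
  have hcont : Tendsto (fun p => inv (J p)) (𝓝 p₀) (𝓝 (z, l)) := by
    have := hcomp.continuousAt.tendsto
    rwa [show inv (J p₀) = (z, l) from hinvz] at this
  refine ⟨fun p => (inv (J p)).1, hcomp.fst, ?_⟩
  have hU : ∀ᶠ x : E d × ℝ in 𝓝 (z, l), x.1 ∈ U ∧ 0 < x.2 :=
    (continuousAt_fst.eventually (hf.1.mem_nhds hf.2.1)).and
      (continuousAt_snd.eventually (lt_mem_nhds hl0))
  filter_upwards [hcont.eventually hU, hJ.continuous.continuousAt.eventually hright]
    with p hp1 hp2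
  have e1 : (inv (J p)).2 • fderiv ℝ f (inv (J p)).1 = innerSL ℝ p := congrArg Prod.fst hp2
  have e2 : f (inv (J p)).1 = 0 := congrArg Prod.snd hp2
  have hmem : (inv (J p)).1 ∈ W := by
    have : (inv (J p)).1 ∈ W ∩ U := hf.2.2.2.1 ▸ ⟨hp1.1, e2.le⟩
    exact this.1
  refine ⟨hmem, le_antisymm (h.inner_le p hmem) ?_⟩
  obtain ⟨w, hw, hwp⟩ := h.exists_inner_eq p
  have h1 := fderiv_sub_nonpos h.convex hf.1 hp1.1 hf.2.2.2.1 e2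
    ((hf.contDiffAt hp1.1).differentiableAt (by simp)) hw
  have h2 : inner ℝ p (w - (inv (J p)).1) ≤ 0 := by
    rw [← innerSL_apply_apply ℝ, ← e1]
    exact mul_nonpos_of_nonneg_of_nonpos hp1.2.le h1
  rw [inner_sub_right, hwp] at h2
  linarith

theorem contDiffAt (h : IsWulffBody Φ W) {p : E d} (hp : p ≠ 0) : ContDiffAt ℝ ∞ Φ p := by
  obtain ⟨Z, hZ, hev⟩ := h.exists_contDiffAt_maximiser hp
  refine (contDiffAt_id.inner ℝ hZ).congr_of_eventuallyEq ?_
  filter_upwards [hev] with q hq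
  exact hq.2.symm

theorem differentiableAt (h : IsWulffBody Φ W) {p : E d} (hp : p ≠ 0) : DifferentiableAt ℝ Φ p :=
  (h.contDiffAt hp).differentiableAt (by simp)

theorem hasGradientAt (h : IsWulffBody Φ W) {p : E d} (hp : p ≠ 0) :
    HasGradientAt Φ (gradient Φ p) p := (h.differentiableAt hp).hasGradientAt

theorem gradient_mem (h : IsWulffBody Φ W) {p : E d} (hp : p ≠ 0) : gradient Φ p ∈ W := by
  obtain ⟨w, hw, hwp⟩ := h.exists_inner_eq p
  rwa [(h.hasGradientAt_of_inner_eq (h.differentiableAt hp) hw hwp).gradient]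

/-- Euler's identity. -/
theorem inner_gradient (h : IsWulffBody Φ W) {p : E d} (hp : p ≠ 0) :
    inner ℝ p (gradient Φ p) = Φ p := by
  obtain ⟨w, hw, hwp⟩ := h.exists_inner_eq p
  rwa [(h.hasGradientAt_of_inner_eq (h.differentiableAt hp) hw hwp).gradient]

theorem contDiffAt_gradient (h : IsWulffBody Φ W) {p : E d} (hp : p ≠ 0) :
    ContDiffAt ℝ ∞ (gradient Φ) p := by
  obtain ⟨Z, hZ, hev⟩ := h.exists_contDiffAt_maximiser hp
  refine hZ.congr_of_eventuallyEq ?_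
  filter_upwards [hev, isOpen_ne.mem_nhds hp] with q hq hq0
  exact (h.hasGradientAt_of_inner_eq (h.differentiableAt hq0) hq.1 hq.2).gradient

/-- A norm has a corner at the origin. -/
theorem not_differentiableAt_zero (h : IsWulffBody Φ W) (hd : 1 ≤ d) :
    ¬ DifferentiableAt ℝ Φ 0 := by
  intro hdiff
  have : Nonempty (Fin d) := ⟨⟨0, hd⟩⟩
  obtain ⟨e, he⟩ := exists_ne (0 : E d)
  have h1 : DifferentiableAt ℝ (fun s : ℝ => Φ (s • e)) 0 := by
    have : DifferentiableAt ℝ Φ ((0 : ℝ) • e) := by simpa using hdiff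
    exact DifferentiableAt.comp (0 : ℝ) this (by fun_prop)
  have h2 : (fun s : ℝ => Φ (s • e)) = fun s => |s| * Φ e := by
    ext s
    rcases le_total 0 s with hs | hs
    · rw [h.apply_smul hs, abs_of_nonneg hs]
    · rw [abs_of_nonpos hs, ← h.apply_smul (neg_nonneg.2 hs), neg_smul, h.apply_neg]
  rw [h2] at h1
  have h3 := h1.mul_const (Φ e)⁻¹
  simp only [mul_assoc, mul_inv_cancel₀ (h.apply_pos he).ne', mul_one] at h3
  exact not_differentiableAt_abs_zero h3

end IsWulffBody

/-! ### The Legendre transform of `Φ² / 2` -/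

/-- The Legendre map `p ↦ Φ(p) ∇Φ(p)`, that is, the gradient of `Φ² / 2`. At the origin, where `∇Φ` is
a junk value, the factor `Φ(0) = 0` gives the correct value `0`. -/
noncomputable def legendreMap (Φ : E d → ℝ) (p : E d) : E d := Φ p • gradient Φ p

namespace IsWulffBody

theorem legendreMap_zero (h : IsWulffBody Φ W) : legendreMap Φ 0 = 0 := by
  simp [legendreMap, h.apply_zero]

theorem gradient_eq (h : IsWulffBody Φ W) {p w : E d} (hp : p ≠ 0) (hw : w ∈ W)
    (hwp : inner ℝ p w = Φ p) : gradient Φ p = w :=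
  (h.hasGradientAt_of_inner_eq (h.differentiableAt hp) hw hwp).gradient

theorem legendreMap_smul (h : IsWulffBody Φ W) {τ : ℝ} (hτ : 0 ≤ τ) (p : E d) :
    legendreMap Φ (τ • p) = τ • legendreMap Φ p := by
  rcases hτ.eq_or_lt with rfl | hτ
  · simp [h.legendreMap_zero]
  by_cases hp : p = 0
  · simp [hp, h.legendreMap_zero]
  have : gradient Φ (τ • p) = gradient Φ p := by
    refine h.gradient_eq (smul_ne_zero hτ.ne' hp) (h.gradient_mem hp) ?_
    rw [real_inner_smul_left, h.inner_gradient hp, h.apply_smul hτ.le]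
  rw [legendreMap, legendreMap, this, h.apply_smul hτ.le, mul_smul]

theorem legendreMap_neg (h : IsWulffBody Φ W) (p : E d) :
    legendreMap Φ (-p) = -legendreMap Φ p := by
  by_cases hp : p = 0
  · simp [hp, h.legendreMap_zero]
  have : gradient Φ (-p) = -gradient Φ p := by
    refine h.gradient_eq (neg_ne_zero.2 hp) (h.neg_mem (h.gradient_mem hp)) ?_
    rw [inner_neg_neg, h.inner_gradient hp, h.apply_neg]
  rw [legendreMap, legendreMap, this, h.apply_neg, smul_neg]

theorem norm_legendreMap_le (h : IsWulffBody Φ W) {ρ : ℝ} (hρ : ∀ w ∈ W, ‖w‖ ≤ ρ) (p : E d) :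
    ‖legendreMap Φ p‖ ≤ ρ * Φ p := by
  by_cases hp : p = 0
  · simp [hp, h.legendreMap_zero, h.apply_zero]
  rw [legendreMap, norm_smul, Real.norm_of_nonneg (h.apply_nonneg p), mul_comm]
  exact mul_le_mul_of_nonneg_right (hρ _ (h.gradient_mem hp)) (h.apply_nonneg p)

theorem hasFDerivAt_sq (h : IsWulffBody Φ W) (p : E d) :
    HasFDerivAt (fun q => Φ q ^ 2) (2 • innerSL ℝ (legendreMap Φ p)) p := by
  by_cases hp : p = 0
  · subst hp
    obtain ⟨m, M, hm, hM, hb⟩ := h.exists_bounds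
    rw [h.legendreMap_zero, map_zero, smul_zero, hasFDerivAt_iff_isLittleO_nhds_zero]
    simp only [zero_add, h.apply_zero, zero_apply, sub_zero, ne_eq, OfNat.ofNat_ne_zero,
      not_false_eq_true, zero_pow]
    have h1 : (fun q : E d => Φ q ^ 2) =O[𝓝 0] fun q => ‖q‖ ^ 2 := by
      refine Asymptotics.IsBigO.of_bound (M ^ 2) (Eventually.of_forall fun q => ?_)
      rw [Real.norm_of_nonneg (by positivity), Real.norm_of_nonneg (by positivity), ← mul_pow]
      exact pow_le_pow_left₀ (h.apply_nonneg q) (hb q).2 2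
    refine h1.trans_isLittleO ?_
    simpa using (Asymptotics.isLittleO_norm_pow_id (E' := E d) one_lt_two)
  · have h1 := (h.hasGradientAt hp).hasFDerivAt.pow 2
    convert! h1 using 1
    ext v
    simp [legendreMap, mul_assoc]

theorem contDiffAt_legendreMap (h : IsWulffBody Φ W) {p : E d} (hp : p ≠ 0) :
    ContDiffAt ℝ ∞ (legendreMap Φ) p :=
  (h.contDiffAt hp).smul (h.contDiffAt_gradient hp)

/-- The Legendre map is homogeneous of degree one and smooth off the origin, hence Lipschitz: by
homogeneity it suffices to compare a unit vector with a vector of the unit ball. -/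
theorem exists_lipschitzWith_legendreMap (h : IsWulffBody Φ W) :
    ∃ K, LipschitzWith K (legendreMap Φ) := by
  obtain ⟨ρ, hρ0, hρ⟩ := h.exists_norm_le
  obtain ⟨m, M, hm, hM, hb⟩ := h.exists_bounds
  have hbound : ∀ p, ‖legendreMap Φ p‖ ≤ ρ * M * ‖p‖ := fun p =>
    (h.norm_legendreMap_le hρ p).trans (by
      rw [mul_assoc]; exact mul_le_mul_of_nonneg_left (hb p).2 hρ0.le)
  let A : Set (E d) := Metric.closedBall 0 1 \ Metric.ball 0 (1 / 2)
  have hA : IsCompact A := (isCompact_closedBall 0 1).diff Metric.isOpen_ball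
  have hloc : LocallyLipschitzOn A (legendreMap Φ) := fun x hx => by
    have hx0 : x ≠ 0 := by
      rintro rfl
      exact hx.2 (by simp)
    obtain ⟨K, t, ht, hK⟩ := ((h.contDiffAt_legendreMap hx0).of_le
      (by exact_mod_cast le_top : (1 : WithTop ℕ∞) ≤ ∞)).exists_lipschitzOnWith
    exact ⟨K, t, mem_nhdsWithin_of_mem_nhds ht, hK⟩
  obtain ⟨K, hK⟩ := hloc.exists_lipschitzOnWith_of_compact hA
  set C : ℝ := max K (3 * (ρ * M)) with hC
  have hC0 : 0 ≤ C := le_max_of_le_left K.2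
  have hρM : 0 < ρ * M := mul_pos hρ0 hM
  have hunit : ∀ p q : E d, ‖p‖ = 1 → ‖q‖ ≤ 1 →
      ‖legendreMap Φ p - legendreMap Φ q‖ ≤ C * ‖p - q‖ := fun p q hp hq => by
    by_cases hq2 : ‖q‖ < 1 / 2
    · have h1 : 1 / 2 ≤ ‖p - q‖ := by linarith [norm_sub_norm_le p q]
      calc ‖legendreMap Φ p - legendreMap Φ q‖
          ≤ ‖legendreMap Φ p‖ + ‖legendreMap Φ q‖ := norm_sub_le _ _
        _ ≤ ρ * M * ‖p‖ + ρ * M * ‖q‖ := add_le_add (hbound p) (hbound q)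
        _ ≤ 3 * (ρ * M) * (1 / 2) := by rw [hp]; nlinarith
        _ ≤ C * ‖p - q‖ := mul_le_mul (le_max_right _ _) h1 (by norm_num) hC0
    · have hpA : p ∈ A := ⟨by simp [hp], by simp [hp]; norm_num⟩
      have hqA : q ∈ A := ⟨by simpa using hq, by simpa using hq2⟩
      have := hK.dist_le_mul p hpA q hqA
      rw [dist_eq_norm, dist_eq_norm] at this
      exact this.trans (mul_le_mul_of_nonneg_right (le_max_left _ _) (norm_nonneg _))
  have hle : ∀ p q : E d, ‖q‖ ≤ ‖p‖ →
      ‖legendreMap Φ p - legendreMap Φ q‖ ≤ C * ‖p - q‖ := fun p q hpq => by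
    by_cases hp : p = 0
    · have hq : q = 0 := by simpa [hp] using hpq
      simp [hp, hq]
    have hn : 0 < ‖p‖ := norm_pos_iff.2 hp
    have h1 := hunit (‖p‖⁻¹ • p) (‖p‖⁻¹ • q) (by simp [norm_smul, hp])
      (by rw [norm_smul, norm_inv, norm_norm, inv_mul_le_iff₀ hn]; simpa using hpq)
    rw [h.legendreMap_smul (inv_nonneg.2 hn.le), h.legendreMap_smul (inv_nonneg.2 hn.le),
      ← smul_sub, ← smul_sub, norm_smul, norm_smul, norm_inv, norm_norm, ← mul_assoc,
      mul_comm C, mul_assoc] at h1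
    exact le_of_mul_le_mul_left h1 (inv_pos.2 hn)
  refine ⟨⟨C, hC0⟩, LipschitzWith.of_dist_le_mul fun p q => ?_⟩
  rw [dist_eq_norm, dist_eq_norm]
  rcases le_total ‖q‖ ‖p‖ with hpq | hpq
  · exact hle p q hpq
  · rw [norm_sub_rev, norm_sub_rev p]
    exact hle q p hpq

/-! ### The gradient of the squared gauge -/

/-- Fenchel's inequality: a covector `q` dual to `u` is a subgradient of `gauge W ^ 2 / 2` at `u`. -/
theorem half_sq_gauge_add_inner_le (h : IsWulffBody Φ W) {u q : E d} (hq : Φ q = gauge W u)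
    (hqu : inner ℝ q u = gauge W u ^ 2) (v : E d) :
    gauge W u ^ 2 / 2 + inner ℝ q (v - u) ≤ gauge W v ^ 2 / 2 := by
  have h1 := h.inner_le_mul_gauge q v
  rw [inner_sub_right, hqu]
  rw [hq] at h1
  nlinarith [sq_nonneg (gauge W u - gauge W v)]

end IsWulffBody

/-- A function with a family of subgradients that is continuous at `u` is differentiable there. -/
theorem hasGradientAt_of_subgradient {G : E d → ℝ} {g : E d → E d} {u : E d}
    (hg : ContinuousAt g u) (hsub : ∀ᶠ v in 𝓝 u, ∀ v', G v + inner ℝ (g v) (v' - v) ≤ G v') :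
    HasGradientAt G (g u) u := by
  rw [hasGradientAt_iff_isLittleO, Asymptotics.isLittleO_iff]
  intro ε hε
  have h0 := hsub.self_of_nhds
  filter_upwards [hsub, Metric.continuousAt_iff'.1 hg ε hε] with v hv hd
  rw [dist_eq_norm] at hd
  have h1 := hv u
  have h2 := h0 v
  have h3 : inner ℝ (g v) (u - v) = -inner ℝ (g v - g u) (v - u) - inner ℝ (g u) (v - u) := by
    rw [inner_sub_left, ← neg_sub v u, inner_neg_right]; ring
  have h4 := (real_inner_le_norm (g v - g u) (v - u)).trans
    (mul_le_mul_of_nonneg_right hd.le (norm_nonneg _))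
  rw [Real.norm_eq_abs, abs_of_nonneg (by linarith)]
  linarith

namespace IsWulffBody

theorem exists_hasGradientAt_half_sq_gauge_of_ne_zero (h : IsWulffBody Φ W) {u : E d}
    (hu : u ≠ 0) : ∃ q, HasGradientAt (fun v => gauge W v ^ 2 / 2) q u ∧ Φ q = gauge W u ∧
      inner ℝ q u = gauge W u ^ 2 := by
  have hfr := h.inv_gauge_smul_mem_frontier hu
  obtain ⟨U, f, hf, -⟩ := h.smooth _ hfr
  let z : E d → E d := fun v => (gauge W v)⁻¹ • v
  let n : E d → E d := fun v => (InnerProductSpace.toDual ℝ (E d)).symm (fderiv ℝ f (z v))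
  let g : E d → E d := fun v => (gauge W v / inner ℝ (n v) (z v)) • n v
  have hnf : ∀ v w, inner ℝ (n v) w = fderiv ℝ f (z v) w := fun v w => by
    simp only [n, InnerProductSpace.toDual_symm_apply]
  have hzc : ContinuousAt z u :=
    (h.continuous_gauge.continuousAt.inv₀ (h.gauge_pos hu).ne').smul continuousAt_id
  have hnc : ContinuousAt n u := by
    have h1 : ContinuousAt (fderiv ℝ f) (z u) :=
      (ContDiffAt.fderiv_right (m := 0) (hf.contDiffAt hf.2.1) (by simp)).continuousAt
    exact (InnerProductSpace.toDual ℝ (E d)).symm.continuous.continuousAt.comp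
      (ContinuousAt.comp h1 hzc)
  have hpair : ∀ v, v ≠ 0 → z v ∈ U → n v ≠ 0 →
      0 < inner ℝ (n v) (z v) ∧ Φ (g v) = gauge W v ∧ inner ℝ (g v) v = gauge W v ^ 2 := by
    intro v hv hvU hn
    have hzfr : z v ∈ frontier W := h.inv_gauge_smul_mem_frontier hv
    have hzW := h.frontier_subset hzfr
    have hΦn : Φ (n v) = inner ℝ (n v) (z v) := by
      refine le_antisymm ?_ (h.inner_le _ hzW)
      obtain ⟨w, hw, hwn⟩ := h.exists_inner_eq (n v)
      have := fderiv_sub_nonpos h.convex hf.1 hvU hf.2.2.2.1 (hf.eq_zero hzfr hzW hvU)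
        ((hf.contDiffAt hvU).differentiableAt (by simp)) hw
      rw [← hnf, inner_sub_right, hwn] at this
      linarith
    have hpos : 0 < inner ℝ (n v) (z v) := hΦn ▸ h.apply_pos hn
    have hgv := h.gauge_pos hv
    refine ⟨hpos, ?_, ?_⟩
    · simp only [g]
      rw [h.apply_smul (by positivity), hΦn, div_mul_cancel₀ _ hpos.ne']
    · have hvz : v = gauge W v • z v := by simp [z, smul_smul, hgv.ne']
      have : inner ℝ (n v) v = gauge W v * inner ℝ (n v) (z v) :=
        (congrArg (inner ℝ (n v)) hvz).trans (real_inner_smul_right _ _ _)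
      simp only [g]
      rw [real_inner_smul_left, this]
      field_simp
  have hnu : n u ≠ 0 := by
    simp only [n, ne_eq, LinearIsometryEquiv.map_eq_zero_iff]
    exact hf.2.2.2.2
  obtain ⟨hpos, h1, h2⟩ := hpair u hu hf.2.1 hnu
  refine ⟨g u, hasGradientAt_of_subgradient (g := g) ?_ ?_, h1, h2⟩
  · exact (h.continuous_gauge.continuousAt.div (hnc.inner hzc) hpos.ne').smul hnc
  · filter_upwards [isOpen_ne.mem_nhds hu, hzc.eventually_mem (hf.1.mem_nhds hf.2.1),
      hnc.eventually_ne hnu] with v hv hvU hvn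
    obtain ⟨-, h3, h4⟩ := hpair v hv hvU hvn
    exact h.half_sq_gauge_add_inner_le h3 h4

/-- The square of the gauge is differentiable, and its gradient inverts the Legendre map. -/
theorem exists_hasGradientAt_half_sq_gauge (h : IsWulffBody Φ W) (u : E d) :
    ∃ q, HasGradientAt (fun v => gauge W v ^ 2 / 2) q u ∧ Φ q = gauge W u ∧
      legendreMap Φ q = u := by
  by_cases hu : u = 0
  · subst hu
    have hex : ∀ v : E d, ∃ q, Φ q = gauge W v ∧ inner ℝ q v = gauge W v ^ 2 := fun v => by
      by_cases hv : v = 0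
      · exact ⟨0, by simp [hv, h.apply_zero], by simp [hv]⟩
      · obtain ⟨q, -, h1, h2⟩ := h.exists_hasGradientAt_half_sq_gauge_of_ne_zero hv
        exact ⟨q, h1, h2⟩
    choose g hg1 hg2 using hex
    have hg0 : g 0 = 0 := h.apply_eq_zero.1 (by rw [hg1, gauge_zero])
    obtain ⟨m, M, hm, hM, hb⟩ := h.exists_bounds
    have hcont : ContinuousAt g 0 := by
      rw [ContinuousAt, hg0, tendsto_zero_iff_norm_tendsto_zero]
      have h1 : Tendsto (fun v => m⁻¹ * gauge W v) (𝓝 (0 : E d)) (𝓝 0) := by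
        have := (h.continuous_gauge.const_mul m⁻¹).tendsto 0
        simpa using this
      refine squeeze_zero (fun _ => norm_nonneg _) (fun v => ?_) h1
      rw [le_inv_mul_iff₀ hm, ← hg1]
      exact (hb _).1
    refine ⟨g 0, hasGradientAt_of_subgradient hcont (Eventually.of_forall fun v =>
      h.half_sq_gauge_add_inner_le (hg1 v) (hg2 v)), hg1 0, ?_⟩
    rw [hg0, h.legendreMap_zero]
  · obtain ⟨q, h0, h1, h2⟩ := h.exists_hasGradientAt_half_sq_gauge_of_ne_zero hu
    refine ⟨q, h0, h1, ?_⟩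
    have hpos := h.gauge_pos hu
    have hq : q ≠ 0 := by
      rintro rfl
      rw [h.apply_zero] at h1
      linarith
    have h3 : gradient Φ q = (gauge W u)⁻¹ • u := by
      refine h.gradient_eq hq (h.frontier_subset (h.inv_gauge_smul_mem_frontier hu)) ?_
      rw [real_inner_smul_right, h2, h1]
      field_simp
    rw [legendreMap, h3, h1, smul_smul, mul_inv_cancel₀ hpos.ne', one_smul]

end IsWulffBody

/-! ### Ordinary differential equations with a priori bounds -/

section ODE

variable {F : Type*} [NormedAddCommGroup F] [NormedSpace ℝ F]

/-- `z` is an integral curve of the autonomous vector field `V` on `[0, T]`. -/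
def IsSolution (V : F → F) (T : ℝ) (z : ℝ → F) : Prop :=
  ∀ s ∈ Icc 0 T, HasDerivWithinAt z (V (z s)) (Icc 0 T) s

theorem IsSolution.continuousOn {V : F → F} {T : ℝ} {z : ℝ → F} (hz : IsSolution V T z) :
    ContinuousOn z (Icc 0 T) := fun s hs => (hz s hs).continuousWithinAt

/-- A locally Lipschitz field in a finite-dimensional space whose solutions from `z₀` obey an a priori
bound up to time `T` has a solution up to time `T`: solve the equation for the field cut off outside a
large ball, and observe that the solution never leaves the ball on which nothing was cut off. -/
theorem exists_isSolution_of_norm_lt [ProperSpace F] {V : F → F} (hV : LocallyLipschitz V)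
    {z₀ : F} {T R : ℝ} (hT : 0 ≤ T)
    (hR : ∀ s ∈ Icc 0 T, ∀ z, z 0 = z₀ → IsSolution V s z → ‖z s‖ < R) :
    ∃ z, z 0 = z₀ ∧ IsSolution V T z := by
  let χ : F → ℝ := fun z => max (min (R + 1 - ‖z‖) 1) 0
  have hχ : LocallyLipschitz χ := by
    have h1 : LocallyLipschitz fun z : F => R + 1 - ‖z‖ := by
      refine (LipschitzWith.of_dist_le_mul (K := 1) fun a b => ?_).locallyLipschitz
      rw [Real.dist_eq, dist_eq_norm, NNReal.coe_one, one_mul,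
        show R + 1 - ‖a‖ - (R + 1 - ‖b‖) = ‖b‖ - ‖a‖ by ring, norm_sub_rev]
      exact abs_norm_sub_norm_le b a
    exact (h1.min_const 1).max_const 0
  let Vc : F → F := fun z => χ z • V z
  have hVc : LocallyLipschitz Vc :=
    ((contDiff_fst.smul contDiff_snd : ContDiff ℝ 1 fun q : ℝ × F => q.1 • q.2).locallyLipschitz).comp
      (hχ.prodMk hV)
  have hVc_eq : ∀ z, ‖z‖ ≤ R → Vc z = V z := fun z hz => by
    have : χ z = 1 := by
      simp only [χ]
      rw [min_eq_right (by linarith), max_eq_left zero_le_one]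
    simp only [Vc, this, one_smul]
  have hVc_zero : ∀ z, R + 1 ≤ ‖z‖ → Vc z = 0 := fun z hz => by
    have : χ z = 0 := by
      simp only [χ]
      rw [max_eq_right ((min_le_left _ _).trans (by linarith))]
    simp only [Vc, this, zero_smul]
  obtain ⟨L, hL⟩ : ∃ L : NNReal, ∀ z, ‖Vc z‖ ≤ L := by
    obtain ⟨L, hL⟩ := (isCompact_closedBall (0 : F) (R + 1)).exists_bound_of_continuousOn
      hVc.continuous.continuousOn
    refine ⟨⟨max L 0, le_max_right _ _⟩, fun z => ?_⟩
    by_cases hz : ‖z‖ ≤ R + 1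
    · exact (hL z (by simpa using hz)).trans (le_max_left _ _)
    · rw [hVc_zero z (by linarith), norm_zero]
      exact le_max_right _ _
  let a : NNReal := L * ⟨T, hT⟩
  obtain ⟨K, hK⟩ := (hVc.locallyLipschitzOn (s := Metric.closedBall z₀ a))
    |>.exists_lipschitzOnWith_of_compact (isCompact_closedBall _ _)
  have hPL : IsPicardLindelof (fun _ => Vc) (tmin := 0) (tmax := T) ⟨0, le_rfl, hT⟩ z₀ a 0 L K :=
    IsPicardLindelof.of_time_independent (fun z _ => hL z) hK (by
      simp only [sub_zero, sub_self, NNReal.coe_zero, max_eq_left hT]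
      exact le_of_eq rfl)
  obtain ⟨z, hz0, hz⟩ := hPL.exists_eq_forall_mem_Icc_hasDerivWithinAt₀
  have hcont : ContinuousOn z (Icc 0 T) := fun s hs => (hz s hs).continuousWithinAt
  have hrestrict : ∀ s ∈ Icc 0 T, (∀ τ ∈ Icc 0 s, ‖z τ‖ ≤ R) → IsSolution V s z :=
    fun s hs hb τ hτ => by
      rw [← hVc_eq _ (hb τ hτ)]
      exact (hz τ ⟨hτ.1, hτ.2.trans hs.2⟩).mono (Icc_subset_Icc_right hs.2)
  have hlt : ∀ s ∈ Icc 0 T, ‖z s‖ < R := by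
    by_contra! hne
    let S : Set ℝ := Icc 0 T ∩ (fun s => ‖z s‖) ⁻¹' Ici R
    have hS : IsClosed S := hcont.norm.preimage_isClosed_of_isClosed isClosed_Icc isClosed_Ici
    have hSbdd : BddBelow S := ⟨0, fun s hs => hs.1.1⟩
    obtain ⟨s₁, hs₁, hs₁R⟩ := hne
    have hmem : sInf S ∈ S := hS.csInf_mem ⟨s₁, hs₁, hs₁R⟩ hSbdd
    set σ := sInf S with hσ
    have hbefore : ∀ τ ∈ Icc 0 T, τ < σ → ‖z τ‖ < R := fun τ hτ hτσ => by
      by_contra! hc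
      exact absurd (csInf_le hSbdd ⟨hτ, hc⟩) (not_le.2 hτσ)
    have hend : ‖z σ‖ ≤ R := by
      rcases hmem.1.1.eq_or_lt with h0 | h0
      · have hsub : IsSolution V 0 z := fun τ hτ => by
          have : (Icc 0 0 : Set ℝ).Subsingleton := by simp
          exact HasFDerivWithinAt.of_subsingleton this
        rw [← h0]
        exact (hR 0 ⟨le_rfl, hT⟩ z hz0 hsub).le
      · have htend : Tendsto (fun τ => ‖z τ‖) (𝓝[<] σ) (𝓝 ‖z σ‖) :=
          ((hcont σ hmem.1).mono_of_mem_nhdsWithin (mem_of_superset (Ioo_mem_nhdsLT h0)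
            fun τ hτ => ⟨hτ.1.le, hτ.2.le.trans hmem.1.2⟩)).norm
        refine le_of_tendsto htend ?_
        filter_upwards [Ioo_mem_nhdsLT h0] with τ hτ
        exact (hbefore τ ⟨hτ.1.le, hτ.2.le.trans hmem.1.2⟩ hτ.2).le
    have hsol : IsSolution V σ z := hrestrict σ hmem.1 fun τ hτ => by
      rcases hτ.2.eq_or_lt with h0 | h0
      · rwa [h0]
      · exact (hbefore τ ⟨hτ.1, hτ.2.trans hmem.1.2⟩ h0).le
    exact absurd hmem.2 (not_le.2 (hR σ hmem.1 z hz0 hsol))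
  exact ⟨z, hz0, hrestrict T ⟨hT, le_rfl⟩ fun τ hτ => (hlt τ hτ).le⟩

/-- Two solutions of a locally Lipschitz equation with the same final value agree. -/
theorem IsSolution.eqOn [ProperSpace F] {V : F → F} (hV : LocallyLipschitz V) {T : ℝ}
    {z₁ z₂ : ℝ → F} (h₁ : IsSolution V T z₁) (h₂ : IsSolution V T z₂) (hT : z₁ T = z₂ T) :
    EqOn z₁ z₂ (Icc 0 T) := by
  obtain ⟨R₁, hR₁⟩ := isCompact_Icc.exists_bound_of_continuousOn h₁.continuousOn
  obtain ⟨R₂, hR₂⟩ := isCompact_Icc.exists_bound_of_continuousOn h₂.continuousOn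
  obtain ⟨K, hK⟩ := (hV.locallyLipschitzOn (s := Metric.closedBall 0 (max R₁ R₂)))
    |>.exists_lipschitzOnWith_of_compact (isCompact_closedBall _ _)
  have hleft : ∀ z, IsSolution V T z → ∀ s ∈ Ioc 0 T, HasDerivWithinAt z (V (z s)) (Iic s) s :=
    fun z hz s hs => (hz s ⟨hs.1.le, hs.2⟩).mono_of_mem_nhdsWithin
      (mem_of_superset (Ioc_mem_nhdsLE hs.1) fun τ hτ => ⟨hτ.1.le, hτ.2.trans hs.2⟩)
  refine ODE_solution_unique_of_mem_Icc_left (v := fun _ => V)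
    (s := fun _ => Metric.closedBall 0 (max R₁ R₂)) (K := K) (fun _ _ => hK) h₁.continuousOn
    (hleft _ h₁) (fun s hs => ?_) h₂.continuousOn (hleft _ h₂) (fun s hs => ?_) hT
  · simpa using Or.inl (hR₁ s ⟨hs.1.le, hs.2⟩)
  · simpa using Or.inr (hR₂ s ⟨hs.1.le, hs.2⟩)

theorem hasDerivWithinAt_fst {F' : Type*} [NormedAddCommGroup F'] [NormedSpace ℝ F']
    {z : ℝ → F × F'} {v : F × F'} {S : Set ℝ} {s : ℝ} (hz : HasDerivWithinAt z v S s) :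
    HasDerivWithinAt (fun τ => (z τ).1) v.1 S s :=
  (ContinuousLinearMap.fst ℝ F F').hasFDerivAt.comp_hasDerivWithinAt s hz

theorem hasDerivWithinAt_snd {F' : Type*} [NormedAddCommGroup F'] [NormedSpace ℝ F']
    {z : ℝ → F × F'} {v : F × F'} {S : Set ℝ} {s : ℝ} (hz : HasDerivWithinAt z v S s) :
    HasDerivWithinAt (fun τ => (z τ).2) v.2 S s :=
  (ContinuousLinearMap.snd ℝ F F').hasFDerivAt.comp_hasDerivWithinAt s hz

/-- Affine change of the time variable of a differentiable curve. -/
theorem hasDerivWithinAt_comp_mul {z : ℝ → F} {v : F} {k r T s : ℝ} (hk : 0 ≤ k) (hkr : k * r ≤ T)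
    (hz : HasDerivWithinAt z v (Icc 0 T) (k * s)) :
    HasDerivWithinAt (fun τ => z (k * τ)) (k • v) (Icc 0 r) s := by
  have h1 : HasDerivWithinAt (fun τ : ℝ => k * τ) k (Icc 0 r) s := by
    simpa using (hasDerivAt_id s).hasDerivWithinAt.const_mul k
  exact hz.scomp s h1 fun τ hτ => ⟨mul_nonneg hk hτ.1, (mul_le_mul_of_nonneg_left hτ.2 hk).trans hkr⟩

theorem IsSolution.comp_mul {V : F → F} {T k r : ℝ} {z : ℝ → F} (hz : IsSolution V T z)
    (hk : 0 ≤ k) (hkr : k * r ≤ T) : IsSolution (fun y => k • V y) r fun τ => z (k * τ) :=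
  fun _ hs => hasDerivWithinAt_comp_mul hk hkr
    (hz _ ⟨mul_nonneg hk hs.1, (mul_le_mul_of_nonneg_left hs.2 hk).trans hkr⟩)

end ODE

/-! ### The Hamiltonian flow of `c² Φ² / 2` -/

/-- The Hamiltonian vector field of `c(x)² Φ(p)² / 2`. Unlike the field of `c(x) Φ(p)` it is locally
Lipschitz across `p = 0`; off `p = 0` the two flows differ by a constant change of the time
scale on each trajectory. -/
noncomputable def squaredField (c Φ : E d → ℝ) (z : E d × E d) : E d × E d :=
  (c z.1 ^ 2 • legendreMap Φ z.2, -((c z.1 * Φ z.2 ^ 2) • gradient c z.1))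

theorem contDiff_gradient (hc : ContDiff ℝ ∞ c) : ContDiff ℝ ∞ (gradient c) := by
  have h1 : ContDiff ℝ ∞ (fderiv ℝ c) := hc.fderiv_right (by simp)
  have h2 : IsBoundedLinearMap ℝ fun l : E d →L[ℝ] ℝ => (InnerProductSpace.toDual ℝ (E d)).symm l :=
    IsLinearMap.with_bound ⟨fun a b => by simp, fun a b => by simp⟩ 1 fun l => by simp
  exact h2.contDiff.comp h1

theorem hasFDerivAt_of_contDiff (hc : ContDiff ℝ ∞ c) (x : E d) :
    HasFDerivAt c (innerSL ℝ (gradient c x)) x := by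
  have := (hc.differentiable (by simp) x).hasGradientAt.hasFDerivAt
  exact this

theorem locallyLipschitz_squaredField (h : IsWulffBody Φ W) (hc : ContDiff ℝ ∞ c) :
    LocallyLipschitz (squaredField c Φ) := by
  obtain ⟨K, hK⟩ := h.exists_lipschitzWith_legendreMap
  let S : E d × E d × ℝ → E d × E d := fun q =>
    (c q.1 ^ 2 • q.2.1, -((c q.1 * q.2.2 ^ 2) • gradient c q.1))
  have hS : ContDiff ℝ 1 S := by
    have hc1 : ContDiff ℝ 1 fun q : E d × E d × ℝ => c q.1 :=
      (hc.of_le (by exact_mod_cast le_top)).comp contDiff_fst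
    have hg1 : ContDiff ℝ 1 fun q : E d × E d × ℝ => gradient c q.1 :=
      ((contDiff_gradient hc).of_le (by exact_mod_cast le_top)).comp contDiff_fst
    have hm : ContDiff ℝ 1 fun q : E d × E d × ℝ => q.2.1 := contDiff_fst.comp contDiff_snd
    have hf : ContDiff ℝ 1 fun q : E d × E d × ℝ => q.2.2 := contDiff_snd.comp contDiff_snd
    exact ((hc1.pow 2).smul hm).prodMk ((hc1.mul (hf.pow 2)).smul hg1).neg
  have h1 : LocallyLipschitz fun z : E d × E d => z.1 := LipschitzWith.prod_fst.locallyLipschitz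
  have h2 : LocallyLipschitz fun z : E d × E d => z.2 := LipschitzWith.prod_snd.locallyLipschitz
  have h3 : LocallyLipschitz fun z : E d × E d => legendreMap Φ z.2 := hK.locallyLipschitz.comp h2
  have h4 : LocallyLipschitz fun z : E d × E d => Φ z.2 := h.convexOn.locallyLipschitz.comp h2
  have hin : LocallyLipschitz fun z : E d × E d => (z.1, legendreMap Φ z.2, Φ z.2) :=
    h1.prodMk (h3.prodMk h4)
  have := hS.locallyLipschitz.comp hin
  exact this

theorem contDiffOn_squaredField (h : IsWulffBody Φ W) (hc : ContDiff ℝ ∞ c) :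
    ContDiffOn ℝ ∞ (squaredField c Φ) {z | z.2 ≠ 0} := by
  intro z hz
  refine ContDiffAt.contDiffWithinAt ?_
  have hc1 : ContDiffAt ℝ ∞ (fun q : E d × E d => c q.1) z := (hc.comp contDiff_fst).contDiffAt
  have hg1 : ContDiffAt ℝ ∞ (fun q : E d × E d => gradient c q.1) z :=
    ((contDiff_gradient hc).comp contDiff_fst).contDiffAt
  have hM : ContDiffAt ℝ ∞ (fun q : E d × E d => legendreMap Φ q.2) z :=
    ContDiffAt.comp z (g := legendreMap Φ) (h.contDiffAt_legendreMap hz) contDiffAt_snd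
  have hP : ContDiffAt ℝ ∞ (fun q : E d × E d => Φ q.2) z :=
    ContDiffAt.comp z (g := Φ) (h.contDiffAt hz) contDiffAt_snd
  exact ((hc1.pow 2).smul hM).prodMk (((hc1.mul (hP.pow 2)).smul hg1).neg)

/-- Conservation of energy: `c Φ` is constant along curves that are everywhere tangent to the
Hamiltonian field, at whatever speed they run. -/
theorem energy_eq (h : IsWulffBody Φ W) (hc : ContDiff ℝ ∞ c) (hpos : ∀ x, 0 < c x) {T : ℝ}
    {z : ℝ → E d × E d} (hz : ∀ s ∈ Icc 0 T, ∃ μ : ℝ,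
      HasDerivWithinAt z (μ • squaredField c Φ (z s)) (Icc 0 T) s) :
    ∀ s ∈ Icc 0 T, c (z s).1 * Φ (z s).2 = c (z 0).1 * Φ (z 0).2 := by
  have hder : ∀ s ∈ Icc 0 T, HasDerivWithinAt (fun s => c (z s).1 ^ 2 * Φ (z s).2 ^ 2) 0
      (Icc 0 T) s := fun s hs => by
    obtain ⟨μ, hμ⟩ := hz s hs
    have h1 : HasDerivWithinAt (fun s => (z s).1) (μ • squaredField c Φ (z s)).1 (Icc 0 T) s :=
      hasDerivWithinAt_fst hμ
    have h2 : HasDerivWithinAt (fun s => (z s).2) (μ • squaredField c Φ (z s)).2 (Icc 0 T) s :=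
      hasDerivWithinAt_snd hμ
    have h3 := ((hasFDerivAt_of_contDiff hc (z s).1).comp_hasDerivWithinAt s h1).pow 2
    have h4 := (h.hasFDerivAt_sq (z s).2).comp_hasDerivWithinAt s h2
    convert! h3.mul h4 using 1
    simp only [squaredField, Prod.smul_fst, Prod.smul_snd, innerSL_apply_apply, smul_apply,
      real_inner_smul_right, inner_neg_right, smul_neg, Function.comp, nsmul_eq_mul, Pi.pow_apply]
    rw [real_inner_comm (gradient c (z s).1)]
    push_cast
    ring
  intro s hs
  have hconst := constant_of_has_deriv_right_zero (a := 0) (b := T)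
    (fun s hs => (hder s hs).continuousWithinAt) (fun s hs =>
      (hder s ⟨hs.1, hs.2.le⟩).mono_of_mem_nhdsWithin (mem_of_superset (Ico_mem_nhdsGE hs.2)
        fun τ hτ => ⟨hs.1.trans hτ.1, hτ.2.le⟩)) s hs
  rw [← mul_pow, ← mul_pow] at hconst
  exact (pow_left_inj₀ (mul_nonneg (hpos _).le (h.apply_nonneg _))
    (mul_nonneg (hpos _).le (h.apply_nonneg _)) two_ne_zero).1 hconst

theorem IsSolution.energy_eq (h : IsWulffBody Φ W) (hc : ContDiff ℝ ∞ c) (hpos : ∀ x, 0 < c x)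
    {T : ℝ} {z : ℝ → E d × E d} (hz : IsSolution (squaredField c Φ) T z) :
    ∀ s ∈ Icc 0 T, c (z s).1 * Φ (z s).2 = c (z 0).1 * Φ (z 0).2 :=
  HJ.energy_eq h hc hpos fun s hs => ⟨1, by rw [one_smul]; exact hz s hs⟩

/-- Trajectories of the squared Hamiltonian exist for all times: by conservation of energy the
momentum is bounded, and so is the velocity. -/
theorem exists_isSolution_squaredField (h : IsWulffBody Φ W) (hc : ContDiff ℝ ∞ c) {c₀ C₀ : ℝ}
    (hc₀ : 0 < c₀) (hcbd : ∀ x, c₀ ≤ c x ∧ c x ≤ C₀) {T : ℝ} (hT : 0 ≤ T) (z₀ : E d × E d) :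
    ∃ z, z 0 = z₀ ∧ IsSolution (squaredField c Φ) T z := by
  obtain ⟨ρ, hρ0, hρ⟩ := h.exists_norm_le
  obtain ⟨m, M, hm, hM, hb⟩ := h.exists_bounds
  have hpos : ∀ x, 0 < c x := fun x => hc₀.trans_le (hcbd x).1
  have hC₀ : 0 < C₀ := hc₀.trans_le ((hcbd 0).1.trans (hcbd 0).2)
  set l := c z₀.1 * Φ z₀.2 with hl
  have hl0 : 0 ≤ l := mul_nonneg (hpos _).le (h.apply_nonneg _)
  refine exists_isSolution_of_norm_lt (R := max (‖z₀.1‖ + C₀ * ρ * l * T) (l / (c₀ * m)) + 1)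
    (locallyLipschitz_squaredField h hc) hT fun s hs z hz0 hz => ?_
  have hen : ∀ τ ∈ Icc 0 s, c (z τ).1 * Φ (z τ).2 = l := fun τ hτ => by
    rw [IsSolution.energy_eq h hc hpos hz τ hτ, hz0]
  have hsmem : s ∈ Icc 0 s := ⟨hs.1, le_rfl⟩
  refine lt_of_le_of_lt (max_le_max ?_ ?_) (lt_add_one _)
  · have hd : ∀ τ ∈ Icc 0 s, HasDerivWithinAt (fun τ => (z τ).1)
        (squaredField c Φ (z τ)).1 (Icc 0 s) τ := fun τ hτ =>
      hasDerivWithinAt_fst (hz τ hτ)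
    have := norm_image_sub_le_of_norm_deriv_le_segment' (C := C₀ * ρ * l) hd (fun τ hτ => by
      have hτ' : τ ∈ Icc 0 s := ⟨hτ.1, hτ.2.le⟩
      calc ‖(squaredField c Φ (z τ)).1‖ = c (z τ).1 ^ 2 * ‖legendreMap Φ (z τ).2‖ := by
            simp only [squaredField]
            rw [norm_smul, Real.norm_of_nonneg (by positivity)]
        _ ≤ c (z τ).1 ^ 2 * (ρ * Φ (z τ).2) := by gcongr; exact h.norm_legendreMap_le hρ _
        _ = c (z τ).1 * ρ * (c (z τ).1 * Φ (z τ).2) := by ring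
        _ = c (z τ).1 * ρ * l := by rw [hen τ hτ']
        _ ≤ C₀ * ρ * l := by gcongr; exact (hcbd _).2) s hsmem
    simp only [hz0, sub_zero] at this
    have h2 : C₀ * ρ * l * s ≤ C₀ * ρ * l * T := by gcongr; exact hs.2
    have h3 := norm_sub_norm_le (z s).1 z₀.1
    linarith
  · rw [le_div_iff₀ (by positivity)]
    calc ‖(z s).2‖ * (c₀ * m) = c₀ * (m * ‖(z s).2‖) := by ring
      _ ≤ c (z s).1 * Φ (z s).2 :=
        mul_le_mul (hcbd _).1 (hb _).1 (by positivity) (hpos _).le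
      _ = l := hen s hsmem

/-- Time reversal: the flow is conjugated to its inverse by `p ↦ -p`. -/
theorem IsSolution.reverse (h : IsWulffBody Φ W) {T : ℝ} {z : ℝ → E d × E d}
    (hz : IsSolution (squaredField c Φ) T z) :
    IsSolution (squaredField c Φ) T fun s => ((z (T - s)).1, -(z (T - s)).2) := by
  intro s hs
  have hs' : T - s ∈ Icc 0 T := ⟨by linarith [hs.2], by linarith [hs.1]⟩
  have h1 : HasDerivWithinAt (fun τ : ℝ => T - τ) (-1) (Icc 0 T) s := by
    simpa using (hasDerivAt_id s).hasDerivWithinAt.const_sub T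
  have h2 : HasDerivWithinAt (fun τ => z (T - τ)) ((-1 : ℝ) • squaredField c Φ (z (T - s)))
      (Icc 0 T) s :=
    (hz _ hs').scomp s h1 fun τ hτ => ⟨by linarith [hτ.2], by linarith [hτ.1]⟩
  have h3 := hasDerivWithinAt_fst h2
  have h4 := (hasDerivWithinAt_snd h2).neg
  convert! h3.prodMk h4 using 1
  simp [squaredField, h.legendreMap_neg, h.apply_neg]

/-! ### Bicharacteristics of `c Φ` -/

theorem hasGradientAt_const_mul {f : E d → ℝ} {a p : E d} (hf : HasGradientAt f a p) (k : ℝ) :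
    HasGradientAt (fun q => k * f q) (k • a) p := by
  rw [hasGradientAt_iff_hasFDerivAt, map_smul]
  exact hf.hasFDerivAt.const_mul k

theorem hasGradientAt_hamiltonian_left (hc : ContDiff ℝ ∞ c) (x p : E d) :
    HasGradientAt (fun y => hamiltonian c Φ y p) (Φ p • gradient c x) x := by
  have := hasGradientAt_const_mul (hc.differentiable (by simp) x).hasGradientAt (Φ p)
  simpa only [hamiltonian, mul_comm] using this

/-- Along a bicharacteristic the momentum does not vanish, since a norm is not differentiable at the
origin; and the bicharacteristic is a trajectory of the squared Hamiltonian, run at the speed given by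
the conserved energy. -/
theorem IsBicharacteristic.isSolution (h : IsWulffBody Φ W) (hd : 1 ≤ d) (hc : ContDiff ℝ ∞ c)
    (hpos : ∀ x, 0 < c x) {r : ℝ} (hr : 0 ≤ r) {γ p : ℝ → E d}
    (hb : IsBicharacteristic (hamiltonian c Φ) r γ p) :
    (∀ s ∈ Icc 0 r, p s ≠ 0) ∧
      IsSolution (fun z => (c (γ r) * Φ (p r))⁻¹ • squaredField c Φ z) r fun s => (γ s, p s) := by
  have hne : ∀ s ∈ Icc 0 r, p s ≠ 0 := fun s hs h0 => by
    obtain ⟨a, b, ha, -⟩ := hb s hs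
    refine h.not_differentiableAt_zero hd ?_
    have h1 := (hasGradientAt_const_mul ha (c (γ s))⁻¹).differentiableAt
    simp only [hamiltonian, inv_mul_cancel_left₀ (hpos (γ s)).ne', h0] at h1
    exact h1
  have hder : ∀ s ∈ Icc 0 r, HasDerivWithinAt (fun s => (γ s, p s))
      ((c (γ s) * Φ (p s))⁻¹ • squaredField c Φ (γ s, p s)) (Icc 0 r) s := fun s hs => by
    obtain ⟨a, b, ha, hb', hγ, hp⟩ := hb s hs
    have hc0 := (hpos (γ s)).ne'
    have hΦ0 := (h.apply_pos (hne s hs)).ne'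
    have ha' := ha.unique (hasGradientAt_const_mul (h.hasGradientAt (hne s hs)) (c (γ s)))
    have hb'' := hb'.unique (hasGradientAt_hamiltonian_left hc (γ s) (p s))
    convert! hγ.prodMk hp using 1
    rw [ha', hb'']
    simp only [squaredField, legendreMap, Prod.smul_mk, smul_smul, smul_neg]
    congr 2 <;> congr 1 <;> field_simp
  have hen := energy_eq h hc hpos (z := fun s => (γ s, p s)) fun s hs => ⟨_, hder s hs⟩
  refine ⟨hne, fun s hs => ?_⟩
  have h1 := hder s hs
  have h2 : c (γ s) * Φ (p s) = c (γ r) * Φ (p r) := (hen s hs).trans (hen r ⟨hr, le_rfl⟩).symm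
  rwa [h2] at h1

theorem isBicharacteristic_of_isSolution (h : IsWulffBody Φ W) (hc : ContDiff ℝ ∞ c)
    (hpos : ∀ x, 0 < c x) {r l : ℝ} (hl : 0 < l) {z : ℝ → E d × E d}
    (hz : IsSolution (fun z => l⁻¹ • squaredField c Φ z) r z)
    (h0 : c (z 0).1 * Φ (z 0).2 = l) :
    IsBicharacteristic (hamiltonian c Φ) r (fun s => (z s).1) (fun s => (z s).2) := by
  intro s hs
  have hen : c (z s).1 * Φ (z s).2 = l :=
    (energy_eq h hc hpos (fun s hs => ⟨_, hz s hs⟩) s hs).trans h0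
  have hΦ0 : Φ (z s).2 ≠ 0 := by
    intro hz0
    rw [hz0, mul_zero] at hen
    exact hl.ne hen
  have hne : (z s).2 ≠ 0 := fun hz0 => hΦ0 (hz0 ▸ h.apply_zero)
  have hc0 := (hpos (z s).1).ne'
  refine ⟨_, _, hasGradientAt_const_mul (h.hasGradientAt hne) (c (z s).1),
    hasGradientAt_hamiltonian_left hc _ _, ?_, ?_⟩
  · convert! hasDerivWithinAt_fst (hz s hs) using 1
    simp only [squaredField, legendreMap, Prod.smul_mk, smul_smul]
    congr 1
    rw [← hen]
    field_simp
  · convert! hasDerivWithinAt_snd (hz s hs) using 1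
    simp only [squaredField, Prod.smul_mk, smul_smul, smul_neg]
    congr 2
    rw [← hen]
    field_simp

/-- A trajectory of the squared Hamiltonian of positive energy `l`, run at unit speed. -/
theorem IsSolution.isBicharacteristic (h : IsWulffBody Φ W) (hc : ContDiff ℝ ∞ c)
    (hpos : ∀ x, 0 < c x) {T l : ℝ} (hl : 0 < l) {z : ℝ → E d × E d}
    (hz : IsSolution (squaredField c Φ) T z) (h0 : c (z 0).1 * Φ (z 0).2 = l) :
    IsBicharacteristic (hamiltonian c Φ) (l * T) (fun s => (z (l⁻¹ * s)).1)
      (fun s => (z (l⁻¹ * s)).2) :=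
  isBicharacteristic_of_isSolution h hc hpos hl
    (hz.comp_mul (inv_nonneg.2 hl.le) (by rw [inv_mul_cancel_left₀ hl.ne'])) (by simpa using h0)

theorem setBWellDefined (h : IsWulffBody Φ W) (hd : 1 ≤ d) (hc : ContDiff ℝ ∞ c) {c₀ C₀ : ℝ}
    (hc₀ : 0 < c₀) (hcbd : ∀ x, c₀ ≤ c x ∧ c x ≤ C₀) (x : E d) (t : ℝ) :
    SetBWellDefined (hamiltonian c Φ) x t := by
  have hpos : ∀ x, 0 < c x := fun x => hc₀.trans_le (hcbd x).1
  intro r hr v hv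
  constructor
  · set l := c x * Φ v with hl
    have hl0 : 0 < l := mul_pos (hpos x) (h.apply_pos hv)
    obtain ⟨z, hz0, hz⟩ := exists_isSolution_squaredField h hc hc₀ hcbd
      (T := l⁻¹ * r) (mul_nonneg (inv_nonneg.2 hl0.le) hr.1) (x, -v)
    have hT : l⁻¹ * r ∈ Icc 0 (l⁻¹ * r) := ⟨mul_nonneg (inv_nonneg.2 hl0.le) hr.1, le_rfl⟩
    have hen := IsSolution.energy_eq h hc hpos hz _ hT
    rw [hz0, h.apply_neg, ← hl] at hen
    have hb := (hz.reverse h).isBicharacteristic h hc hpos hl0 (by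
      simpa [h.apply_neg] using hen)
    rw [mul_inv_cancel_left₀ hl0.ne'] at hb
    exact ⟨_, _, hb, by simp [hz0], by simp [hz0]⟩
  · intro γ₁ p₁ γ₂ p₂ h₁ hx₁ hv₁ h₂ hx₂ hv₂
    have hs₁ := (h₁.isSolution h hd hc hpos hr.1).2
    have hs₂ := (h₂.isSolution h hd hc hpos hr.1).2
    rw [hx₁, hv₁] at hs₁
    rw [hx₂, hv₂] at hs₂
    have hV : LocallyLipschitz fun z => (c x * Φ v)⁻¹ • squaredField c Φ z :=
      (lipschitzWith_smul (c x * Φ v)⁻¹).locallyLipschitz.comp (locallyLipschitz_squaredField h hc)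
    have heq := hs₁.eqOn hV hs₂ (by simp only [hx₁, hv₁, hx₂, hv₂])
    exact ⟨fun s hs => congrArg Prod.fst (heq hs), fun s hs => congrArg Prod.snd (heq hs)⟩

theorem IsBicharacteristic.contDiffOn (h : IsWulffBody Φ W) (hd : 1 ≤ d) (hc : ContDiff ℝ ∞ c)
    (hpos : ∀ x, 0 < c x) {r : ℝ} (hr : 0 ≤ r) {γ p : ℝ → E d}
    (hb : IsBicharacteristic (hamiltonian c Φ) r γ p) : ContDiffOn ℝ ∞ γ (Icc 0 r) := by
  obtain ⟨hne, hs⟩ := hb.isSolution h hd hc hpos hr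
  have h1 : ContDiffOn ℝ ∞
      (Function.uncurry fun (_ : ℝ) z => (c (γ r) * Φ (p r))⁻¹ • squaredField c Φ z)
      (Icc 0 r ×ˢ {z | z.2 ≠ 0}) :=
    ((contDiffOn_squaredField h hc).const_smul (c (γ r) * Φ (p r))⁻¹).comp contDiffOn_snd
      fun _ hz => hz.2
  exact contDiff_fst.comp_contDiffOn
    (ODE.contDiffOn_enat_Icc_of_hasDerivWithinAt (n := ⊤) h1 hs fun s hs => hne s hs)

/-! ### Limiting subgradients of the Hamiltonian -/

/-- At any point, a limiting subgradient of a multiple of the norm `Φ` is a covector bounded by it. -/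
theorem inner_le_of_mem_mordukhovichSubdifferential (h : IsWulffBody Φ W) {k : ℝ} (hk : 0 < k)
    {p a : E d} (ha : a ∈ mordukhovichSubdifferential (fun q => k * Φ q) p) (u : E d) :
    inner ℝ u a ≤ k * Φ u := by
  obtain ⟨q, η, -, -, hη, hlim⟩ := ha
  refine le_of_tendsto (tendsto_const_nhds.inner hlim) (Eventually.of_forall fun n => ?_)
  refine le_of_forall_pos_le_add fun ε hε => ?_
  have hδ : 0 < ε / (‖u‖ + 1) := by positivity
  have h1 := hη n _ hδ
  have h2 : Tendsto (fun s : ℝ => q n + s • u) (𝓝[>] 0) (𝓝 (q n)) := by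
    have : Continuous fun s : ℝ => q n + s • u := by fun_prop
    simpa using (this.tendsto 0).mono_left nhdsWithin_le_nhds
  obtain ⟨s, hs, hs0 : 0 < s⟩ := ((h2.eventually h1).and self_mem_nhdsWithin).exists
  simp only [add_sub_cancel_left, norm_smul, Real.norm_of_nonneg hs0.le,
    real_inner_smul_right] at hs
  have h3 : Φ (q n + s • u) ≤ Φ (q n) + s * Φ u := by
    simpa [h.apply_smul hs0.le] using h.apply_add_le (q n) (s • u)
  have h4 : k * Φ (q n + s • u) ≤ k * (Φ (q n) + s * Φ u) := by gcongr
  have h5 : ε / (‖u‖ + 1) * ‖u‖ ≤ ε := by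
    rw [div_mul_eq_mul_div, div_le_iff₀ (by positivity)]
    nlinarith [norm_nonneg u]
  have h6 : s * (inner ℝ (η n) u) ≤ s * (k * Φ u + ε / (‖u‖ + 1) * ‖u‖) := by nlinarith
  have h7 := le_of_mul_le_mul_left h6 hs0
  rw [real_inner_comm]
  linarith

theorem smul_mem_mordukhovichSubdifferential_zero (h : IsWulffBody Φ W) {k : ℝ} (hk : 0 ≤ k)
    {w : E d} (hw : w ∈ W) : k • w ∈ mordukhovichSubdifferential (fun q => k * Φ q) 0 := by
  refine ⟨fun _ => 0, fun _ => k • w, tendsto_const_nhds, tendsto_const_nhds, fun _ ε hε => ?_,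
    tendsto_const_nhds⟩
  refine Eventually.of_forall fun q => ?_
  simp only [sub_zero, h.apply_zero, mul_zero, real_inner_smul_left]
  have h1 := mul_le_mul_of_nonneg_left (h.inner_le q hw) hk
  rw [real_inner_comm] at h1
  nlinarith [norm_nonneg q]

/-- Slowing a bicharacteristic down to last exactly the time `t` keeps it admissible, and with
vanishing momentum every admissible curve solves the inclusion system. -/
theorem setB_subset_setC (h : IsWulffBody Φ W) (hd : 1 ≤ d) (hc : ContDiff ℝ ∞ c)
    (hpos : ∀ x, 0 < c x) (x : E d) {t : ℝ} (ht : 0 < t) :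
    setB (hamiltonian c Φ) x t ⊆ setC (hamiltonian c Φ) x t := by
  intro y hy
  simp only [setB, mem_iUnion] at hy
  obtain ⟨r, hr, v, -, γ, p, hb, hx, -, hy⟩ := hy
  have hne := (hb.isSolution h hd hc hpos hr.1).1
  have hk0 : 0 ≤ r / t := div_nonneg hr.1 ht.le
  have hk1 : r / t ≤ 1 := (div_le_one ht).2 hr.2
  have hkt : r / t * t = r := div_mul_cancel₀ _ ht.ne'
  have hmaps : MapsTo (fun s => r / t * s) (Icc 0 t) (Icc 0 r) := fun s hs =>
    ⟨mul_nonneg hk0 hs.1, (mul_le_mul_of_nonneg_left hs.2 hk0).trans hkt.le⟩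
  refine mem_iUnion.2 ⟨0, fun s => γ (r / t * s), fun _ => 0, ?_, contDiffOn_const, ?_,
    by simp only [hkt, hx], rfl, by simp only [mul_zero, hy]⟩
  · exact (hb.contDiffOn h hd hc hpos hr.1).comp (contDiff_const.mul contDiff_id).contDiffOn hmaps
  · intro s hs
    obtain ⟨a, b, ha, -, hγ, -⟩ := hb _ (hmaps hs)
    have ha' := ha.unique (hasGradientAt_const_mul (h.hasGradientAt (hne _ (hmaps hs))) _)
    refine ⟨(r / t) • a, 0, ?_, ?_, hasDerivWithinAt_comp_mul hk0 hkt.le hγ, ?_⟩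
    · rw [ha', smul_comm]
      refine smul_mem_mordukhovichSubdifferential_zero h (hpos _).le ?_
      have := h.convex h.zero_mem (h.gradient_mem (hne _ (hmaps hs)))
        (sub_nonneg.2 hk1) hk0 (by ring)
      simpa using this
    · have := hasGradientAt_hamiltonian_left (Φ := Φ) hc (γ (r / t * s)) 0
      rwa [h.apply_zero, zero_smul] at this
    · simpa using hasDerivWithinAt_const s (Icc 0 t) (0 : E d)

/-! ### Minimisers of the discrete action -/

/-- The cost of a straight step from `a` to `b` in unit time: the Lagrangian of `c² Φ² / 2`, evaluated
at the starting point and the displacement. -/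
noncomputable def stepCost (c : E d → ℝ) (W : Set (E d)) (a b : E d) : ℝ :=
  gauge W (b - a) ^ 2 / 2 / c a ^ 2

/-- The total cost of the first `N` steps of the sequence `X`. -/
noncomputable def discreteAction (c : E d → ℝ) (W : Set (E d)) (N : ℕ) (X : ℕ → E d) : ℝ :=
  ∑ k ∈ Finset.range N, stepCost c W (X k) (X (k + 1))

theorem continuous_discreteAction (h : IsWulffBody Φ W) (hc : Continuous c) (hpos : ∀ x, 0 < c x)
    (N : ℕ) : Continuous (discreteAction c W N) := by
  refine continuous_finsetSum _ fun k _ => ?_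
  have h1 : Continuous fun X : ℕ → E d => gauge W (X (k + 1) - X k) :=
    h.continuous_gauge.comp ((continuous_apply _).sub (continuous_apply _))
  have h2 : Continuous fun X : ℕ → E d => c (X k) := hc.comp (continuous_apply _)
  exact ((h1.pow 2).div_const 2).div (h2.pow 2) fun X => (pow_pos (hpos _) 2).ne'

/-- A bound on the action bounds the length, by the Cauchy–Schwarz inequality. -/
theorem sum_gauge_le_of_discreteAction_le {C₀ : ℝ} (hpos : ∀ x, 0 < c x) (hC₀ : ∀ x, c x ≤ C₀)
    {N : ℕ} {X : ℕ → E d} {σ : ℝ} (hσ : 0 ≤ σ)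
    (hX : discreteAction c W N X ≤ N * (σ ^ 2 / 2)) :
    ∑ k ∈ Finset.range N, gauge W (X (k + 1) - X k) ≤ C₀ * (N * σ) := by
  have hC : 0 < C₀ := (hpos 0).trans_le (hC₀ 0)
  refine abs_le_of_sq_le_sq' ?_ (by positivity) |>.2
  calc (∑ k ∈ Finset.range N, gauge W (X (k + 1) - X k)) ^ 2
      ≤ N * ∑ k ∈ Finset.range N, gauge W (X (k + 1) - X k) ^ 2 := by
        simpa using sq_sum_le_card_mul_sum_sq (s := Finset.range N)
          (f := fun k => gauge W (X (k + 1) - X k))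
    _ ≤ N * ∑ k ∈ Finset.range N, 2 * C₀ ^ 2 * stepCost c W (X k) (X (k + 1)) := by
        gcongr with k hk
        have h1 := hpos (X k)
        rw [stepCost, ← mul_div_assoc, le_div_iff₀ (by positivity)]
        have h2 : c (X k) ^ 2 ≤ C₀ ^ 2 := pow_le_pow_left₀ h1.le (hC₀ _) 2
        nlinarith [sq_nonneg (gauge W (X (k + 1) - X k))]
    _ = N * (2 * C₀ ^ 2 * discreteAction c W N X) := by rw [← Finset.mul_sum, discreteAction]
    _ ≤ N * (2 * C₀ ^ 2 * (N * (σ ^ 2 / 2))) := by gcongr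
    _ = (C₀ * (N * σ)) ^ 2 := by ring

theorem norm_sub_le_sum_gauge (h : IsWulffBody Φ W) {ρ : ℝ} (hρ0 : 0 ≤ ρ) (hρ : ∀ w ∈ W, ‖w‖ ≤ ρ)
    {N k : ℕ} (hk : k ≤ N) (X : ℕ → E d) :
    ‖X k - X 0‖ ≤ ρ * ∑ i ∈ Finset.range N, gauge W (X (i + 1) - X i) := by
  rw [← dist_eq_norm, dist_comm]
  calc dist (X 0) (X k) ≤ ∑ i ∈ Finset.range k, dist (X i) (X (i + 1)) := dist_le_range_sum_dist X k
    _ ≤ ∑ i ∈ Finset.range k, ρ * gauge W (X (i + 1) - X i) := by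
        gcongr with i _
        rw [dist_comm, dist_eq_norm]
        exact h.norm_le_mul_gauge hρ _
    _ ≤ ∑ i ∈ Finset.range N, ρ * gauge W (X (i + 1) - X i) :=
        Finset.sum_le_sum_of_subset_of_nonneg (by simpa using hk)
          fun i _ _ => mul_nonneg hρ0 (gauge_nonneg _)
    _ = _ := by rw [← Finset.mul_sum]

/-- Moving one interior vertex changes only the two adjacent steps. -/
theorem discreteAction_update_sub {N j : ℕ} (hj : j + 1 < N) (X : ℕ → E d) (z : E d) :
    discreteAction c W N (Function.update X (j + 1) z) - discreteAction c W N X =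
      (stepCost c W (X j) z + stepCost c W z (X (j + 2))) -
        (stepCost c W (X j) (X (j + 1)) + stepCost c W (X (j + 1)) (X (j + 2))) := by
  rw [discreteAction, discreteAction, ← Finset.sum_sub_distrib,
    Finset.sum_eq_add (j) (j + 1) (by omega)]
  · simp only [Function.update_self, Function.update_of_ne (show j ≠ j + 1 by omega),
      Function.update_of_ne (show j + 1 + 1 ≠ j + 1 by omega)]
    ring
  · rintro i - ⟨hi1, hi2⟩
    rw [Function.update_of_ne hi2, Function.update_of_ne (show i + 1 ≠ j + 1 by omega), sub_self]
  · intro hn; exact absurd (Finset.mem_range.2 (by omega)) hn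
  · intro hn; exact absurd (Finset.mem_range.2 (by omega)) hn

/-- The discrete Euler–Lagrange equation at a vertex `b` with neighbours `a` and `a'`. -/
theorem eq_of_isLocalMin_stepCost (hc : ContDiff ℝ ∞ c) (hpos : ∀ x, 0 < c x)
    {a b a' q q' : E d}
    (hq : HasGradientAt (fun v => gauge W v ^ 2 / 2) q (b - a))
    (hq' : HasGradientAt (fun v => gauge W v ^ 2 / 2) q' (a' - b))
    (hmin : IsLocalMin (fun z => stepCost c W a z + stepCost c W z a') b) :
    (c a ^ 2)⁻¹ • q =
      (c b ^ 2)⁻¹ • q' + (gauge W (a' - b) ^ 2 / c b ^ 3) • gradient c b := by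
  refine ext_inner_right ℝ fun v => ?_
  have hline : HasDerivAt (fun s : ℝ => b + s • v) v 0 := by
    simpa using ((hasDerivAt_id (0 : ℝ)).smul_const v).const_add b
  have h1 : HasDerivAt (fun s : ℝ => gauge W (b + s • v - a) ^ 2 / 2) (inner ℝ q v) 0 := by
    have h0 : HasFDerivAt (fun v => gauge W v ^ 2 / 2) (innerSL ℝ q) (b + (0 : ℝ) • v - a) := by
      rw [zero_smul, add_zero]
      exact hq.hasFDerivAt
    exact h0.comp_hasDerivAt (0 : ℝ) (hline.sub_const a)
  have h2 : HasDerivAt (fun s : ℝ => gauge W (a' - (b + s • v)) ^ 2 / 2) (inner ℝ q' (-v)) 0 := by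
    have h0 : HasFDerivAt (fun v => gauge W v ^ 2 / 2) (innerSL ℝ q') (a' - (b + (0 : ℝ) • v)) := by
      rw [zero_smul, add_zero]
      exact hq'.hasFDerivAt
    exact h0.comp_hasDerivAt (0 : ℝ) (hline.const_sub a')
  have h3 : HasDerivAt (fun s : ℝ => c (b + s • v)) (inner ℝ (gradient c b) v) 0 := by
    have h0 : HasFDerivAt c (innerSL ℝ (gradient c b)) (b + (0 : ℝ) • v) := by
      simpa using hasFDerivAt_of_contDiff hc b
    exact h0.comp_hasDerivAt (0 : ℝ) hline
  have h4 := (h1.div_const (c a ^ 2)).add (h2.div (h3.pow 2) (pow_pos (hpos _) 2).ne')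
  have hmin' : IsLocalMin (fun s : ℝ => stepCost c W a (b + s • v) + stepCost c W (b + s • v) a')
      0 := by
    have hcont : Tendsto (fun s : ℝ => b + s • v) (𝓝 0) (𝓝 b) := by
      simpa using hline.continuousAt.tendsto
    have := hcont.eventually hmin
    simpa [IsLocalMin, IsMinFilter] using this
  have h5 := hmin'.hasDerivAt_eq_zero h4
  have hca := (hpos a).ne'
  have hcb := (hpos b).ne'
  simp only [zero_smul, add_zero, inner_neg_right, Pi.pow_apply] at h5
  simp only [inner_add_left, real_inner_smul_left]
  have h6 : inner ℝ q v / c a ^ 2 = (inner ℝ q' v * c b ^ 2 +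
      gauge W (a' - b) ^ 2 / 2 * (2 * c b * inner ℝ (gradient c b) v)) / (c b ^ 2) ^ 2 := by
    have e : (2 : ℕ) - 1 = 1 := rfl
    rw [e] at h5
    push_cast at h5
    rw [pow_one] at h5
    rw [← sub_eq_zero, ← h5]
    ring
  rw [inv_mul_eq_div, h6]
  field_simp

/-- A minimiser of the discrete action satisfies the symplectic Euler scheme for the squared
Hamiltonian. The sequence `Y` is a competitor of step size `τ` and mean speed at most `κ`. -/
theorem exists_symplecticEuler (h : IsWulffBody Φ W) (hc : ContDiff ℝ ∞ c) (hpos : ∀ x, 0 < c x)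
    {C₀ ρ : ℝ} (hC₀ : ∀ x, c x ≤ C₀) (hρ0 : 0 ≤ ρ) (hρ : ∀ w ∈ W, ‖w‖ ≤ ρ)
    {N : ℕ} (hN : 0 < N) {τ κ : ℝ} (hτ : 0 < τ) (hκ : 0 ≤ κ) {x y : E d} {Y : ℕ → E d}
    (hY0 : Y 0 = y) (hYN : ∀ k, N ≤ k → Y k = x)
    (hY : ∀ k < N, gauge W (Y (k + 1) - Y k) ≤ τ * κ * c (Y k)) :
    ∃ X P : ℕ → E d, X 0 = y ∧ X N = x ∧
      (∀ k < N, X (k + 1) = X k + τ • c (X k) ^ 2 • legendreMap Φ (P k)) ∧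
      (∀ k, k + 1 < N → P k =
        P (k + 1) + τ • (c (X (k + 1)) * Φ (P (k + 1)) ^ 2) • gradient c (X (k + 1))) ∧
      (∑ k ∈ Finset.range N, (c (X k) * Φ (P k)) ^ 2 ≤ N * κ ^ 2) ∧
      ∀ k ≤ N, ‖X k - y‖ ≤ ρ * (C₀ * (N * (τ * κ))) := by
  set R₀ : ℝ := ρ * (C₀ * (N * (τ * κ))) with hR₀
  have hτκ : 0 ≤ τ * κ := by positivity
  have hbound : ∀ X : ℕ → E d, X 0 = y → discreteAction c W N X ≤ N * ((τ * κ) ^ 2 / 2) →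
      ∀ k ≤ N, ‖X k - y‖ ≤ R₀ := fun X hX0 hX k hk => by
    rw [← hX0]
    exact (norm_sub_le_sum_gauge h hρ0 hρ hk X).trans (mul_le_mul_of_nonneg_left
      (sum_gauge_le_of_discreteAction_le hpos hC₀ hτκ hX) hρ0)
  have hYact : discreteAction c W N Y ≤ N * ((τ * κ) ^ 2 / 2) := by
    calc discreteAction c W N Y ≤ ∑ k ∈ Finset.range N, (τ * κ) ^ 2 / 2 := by
          refine Finset.sum_le_sum fun k hk => ?_
          have h1 := hpos (Y k)
          rw [stepCost, div_le_iff₀ (by positivity)]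
          have := pow_le_pow_left₀ (gauge_nonneg _) (hY k (Finset.mem_range.1 hk)) 2
          nlinarith
      _ = _ := by simp
  -- the admissible sequences: endpoints pinned, everything else in a ball with room to spare
  let S : ℕ → Set (E d) := fun k =>
    if k = 0 then {y} else if N ≤ k then {x} else Metric.closedBall y (R₀ + 1)
  have hS : IsCompact (univ.pi S) := isCompact_univ_pi fun k => by
    simp only [S]
    split_ifs
    · exact isCompact_singleton
    · exact isCompact_singleton
    · exact isCompact_closedBall _ _
  have hYS : Y ∈ univ.pi S := fun k _ => by
    simp only [S]
    split_ifs with h1 h2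
    · rw [h1, hY0]; rfl
    · exact hYN k h2
    · rw [mem_closedBall_iff_norm]
      exact (hbound Y hY0 hYact k (by omega)).trans (by linarith)
  obtain ⟨X, hXS, hXmin⟩ := hS.exists_isMinOn ⟨Y, hYS⟩
    (continuous_discreteAction h hc.continuous hpos N).continuousOn
  have hX0 : X 0 = y := by simpa [S] using hXS 0 (mem_univ _)
  have hXN : X N = x := by simpa [S, hN.ne'] using hXS N (mem_univ _)
  have hXact : discreteAction c W N X ≤ N * ((τ * κ) ^ 2 / 2) := (hXmin hYS).trans hYact
  have hXb := hbound X hX0 hXact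
  choose g hg1 hg2 hg3 using fun u => h.exists_hasGradientAt_half_sq_gauge u
  let q : ℕ → E d := fun k => g (X (k + 1) - X k)
  let P : ℕ → E d := fun k => (τ * c (X k) ^ 2)⁻¹ • q k
  have hw : ∀ k, 0 < τ * c (X k) ^ 2 := fun k => mul_pos hτ (pow_pos (hpos _) 2)
  have hqP : ∀ k, q k = (τ * c (X k) ^ 2) • P k := fun k => by
    simp only [P, smul_smul, mul_inv_cancel₀ (hw k).ne', one_smul]
  have hgauge : ∀ k, gauge W (X (k + 1) - X k) = τ * c (X k) ^ 2 * Φ (P k) := fun k => by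
    rw [← hg2, ← h.apply_smul (hw k).le, ← hqP]
  clear_value P
  refine ⟨X, P, hX0, hXN, fun k _ => ?_, fun k hk => ?_, ?_, hXb⟩
  · have h1 : legendreMap Φ (q k) = X (k + 1) - X k := hg3 _
    rw [hqP, h.legendreMap_smul (hw k).le, mul_smul] at h1
    rw [h1, add_sub_cancel]
  · have hmin : IsLocalMin (fun z => stepCost c W (X k) z + stepCost c W z (X (k + 2)))
        (X (k + 1)) := by
      have hball : Metric.closedBall y (R₀ + 1) ∈ 𝓝 (X (k + 1)) := by
        refine mem_of_superset (Metric.isOpen_ball.mem_nhds ?_) Metric.ball_subset_closedBall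
        rw [mem_ball_iff_norm]
        exact (hXb _ hk.le).trans_lt (lt_add_one _)
      filter_upwards [hball] with z hz
      have hmem : Function.update X (k + 1) z ∈ univ.pi S := fun i _ => by
        by_cases hi : i = k + 1
        · subst hi
          rw [Function.update_self]
          simp only [S]
          rwa [if_neg (by omega), if_neg (by omega)]
        · rw [Function.update_of_ne hi]
          exact hXS i (mem_univ _)
      have h1 := hXmin hmem
      simp only [mem_ofPred_eq] at h1
      have h2 := discreteAction_update_sub (c := c) (W := W) hk X z
      linarith
    have hEL := eq_of_isLocalMin_stepCost hc hpos (hg1 _) (hg1 _) hmin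
    change (c (X k) ^ 2)⁻¹ • q k = (c (X (k + 1)) ^ 2)⁻¹ • q (k + 1) + _ at hEL
    rw [hqP k, hqP (k + 1), hgauge (k + 1), smul_smul, smul_smul] at hEL
    have hck := (hpos (X k)).ne'
    have hck1 := (hpos (X (k + 1))).ne'
    have e1 : (c (X k) ^ 2)⁻¹ * (τ * c (X k) ^ 2) = τ := by field_simp
    have e2 : (c (X (k + 1)) ^ 2)⁻¹ * (τ * c (X (k + 1)) ^ 2) = τ := by field_simp
    have e3 : (τ * c (X (k + 1)) ^ 2 * Φ (P (k + 1))) ^ 2 / c (X (k + 1)) ^ 3 =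
        τ * (τ * (c (X (k + 1)) * Φ (P (k + 1)) ^ 2)) := by field_simp
    rw [e1, e2, e3, mul_smul, ← smul_add, mul_smul] at hEL
    exact smul_right_injective _ hτ.ne' hEL
  · have h1 : discreteAction c W N X =
        ∑ k ∈ Finset.range N, τ ^ 2 / 2 * (c (X k) * Φ (P k)) ^ 2 := by
      refine Finset.sum_congr rfl fun k _ => ?_
      have hck := (hpos (X k)).ne'
      rw [stepCost, hgauge]
      field_simp
    rw [h1, ← Finset.mul_sum] at hXact
    have hτ2 : 0 < τ ^ 2 / 2 := by positivity
    refine le_of_mul_le_mul_left (hXact.trans_eq ?_) hτ2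
    ring

/-! ### Convergence of the symplectic Euler scheme -/

section Euler

variable {F₁ F₂ : Type*} [NormedAddCommGroup F₁] [NormedSpace ℝ F₁] [NormedAddCommGroup F₂]
  [NormedSpace ℝ F₂]

theorem IsSolution.norm_sub_le {F : Type*} [NormedAddCommGroup F] [NormedSpace ℝ F] {V : F → F}
    {T B : ℝ} {z : ℝ → F} (hz : IsSolution V T z) (hB : ∀ s ∈ Icc 0 T, ‖V (z s)‖ ≤ B) {a b : ℝ}
    (ha : 0 ≤ a) (hab : a ≤ b) (hb : b ≤ T) : ‖z b - z a‖ ≤ B * (b - a) :=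
  norm_image_sub_le_of_norm_deriv_le_segment' (f' := fun s => V (z s))
    (fun s hs => (hz s ⟨ha.trans hs.1, hs.2.trans hb⟩).mono (Icc_subset_Icc ha hb))
    (fun s hs => hB s ⟨ha.trans hs.1, hs.2.le.trans hb⟩) b ⟨hab, le_rfl⟩

/-- The local error of an Euler step is quadratic in the step size. -/
theorem IsSolution.norm_sub_sub_le {F : Type*} [NormedAddCommGroup F] [NormedSpace ℝ F] {V : F → F}
    {T B : ℝ} {K : NNReal} {A : Set F} {z : ℝ → F} (hz : IsSolution V T z)
    (hK : LipschitzOnWith K V A) (hA : ∀ s ∈ Icc 0 T, z s ∈ A)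
    (hB : ∀ s ∈ Icc 0 T, ‖V (z s)‖ ≤ B) {a b : ℝ} (ha : 0 ≤ a) (hab : a ≤ b) (hb : b ≤ T) :
    ‖z b - z a - (b - a) • V (z a)‖ ≤ K * B * (b - a) ^ 2 := by
  have haT : a ∈ Icc 0 T := ⟨ha, hab.trans hb⟩
  have hder : ∀ s ∈ Icc a b, HasDerivWithinAt (fun s => z s - s • V (z a)) (V (z s) - V (z a))
      (Icc a b) s := fun s hs => by
    have h1 := (hz s ⟨ha.trans hs.1, hs.2.trans hb⟩).mono (Icc_subset_Icc ha hb)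
    have h2 := (hasDerivAt_id s).hasDerivWithinAt (s := Icc a b) |>.smul_const (V (z a))
    rw [one_smul] at h2
    exact h1.sub h2
  have hbd : ∀ s ∈ Ico a b, ‖V (z s) - V (z a)‖ ≤ K * B * (b - a) := fun s hs => by
    have hsT : s ∈ Icc 0 T := ⟨ha.trans hs.1, hs.2.le.trans hb⟩
    have hB0 : 0 ≤ B := (norm_nonneg _).trans (hB a haT)
    have h1 := hK.dist_le_mul _ (hA s hsT) _ (hA a haT)
    rw [dist_eq_norm, dist_eq_norm] at h1
    have h2 := hz.norm_sub_le hB ha hs.1 hsT.2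
    calc ‖V (z s) - V (z a)‖ ≤ K * ‖z s - z a‖ := h1
      _ ≤ K * (B * (s - a)) := by gcongr
      _ ≤ K * (B * (b - a)) := by gcongr; exact hs.2.le
      _ = _ := by ring
  have := norm_image_sub_le_of_norm_deriv_le_segment' hder hbd b ⟨hab, le_rfl⟩
  calc ‖z b - z a - (b - a) • V (z a)‖ = ‖z b - b • V (z a) - (z a - a • V (z a))‖ := by
        congr 1; module
    _ ≤ _ := this.trans_eq (by ring)

/-- The global error of the symplectic Euler scheme, in which the first component of the field is
evaluated at the old point and the second component at the new point. -/
theorem norm_sub_le_of_symplecticEuler {V : F₁ × F₂ → F₁ × F₂} {T B τ : ℝ} {K : NNReal}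
    {A : Set (F₁ × F₂)} {z : ℝ → F₁ × F₂} (hz : IsSolution V T z) (hK : LipschitzOnWith K V A)
    (hzA : ∀ s ∈ Icc 0 T, z s ∈ A) (hB : ∀ w ∈ A, ‖V w‖ ≤ B) (hτ : 0 ≤ τ) {N : ℕ}
    (hN : N * τ = T) {Z : ℕ → F₁ × F₂} (hZA : ∀ k < N, Z k ∈ A)
    (hZ : ∀ k, k + 1 < N → Z (k + 1) = Z k + τ • ((V (Z k)).1, (V (Z (k + 1))).2)) :
    ∀ k < N, ‖Z k - z (k * τ)‖ ≤ (‖Z 0 - z 0‖ + T * (2 * K * B * τ)) * Real.exp (K * T) := by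
  intro k hk
  have hT : 0 ≤ T := hN ▸ by positivity
  have hB0 : 0 ≤ B := (norm_nonneg _).trans (hB _ (hZA k hk))
  have hmemT : ∀ j ≤ N, (j : ℝ) * τ ∈ Icc 0 T := fun j hj =>
    ⟨by positivity, hN ▸ mul_le_mul_of_nonneg_right (by exact_mod_cast hj) hτ⟩
  have hstep : ∀ j, j + 1 < N → ‖Z (j + 1) - z ((j + 1 : ℕ) * τ)‖ ≤
      (1 + K * τ) * ‖Z j - z (j * τ)‖ + 2 * K * B * τ ^ 2 := fun j hj => by
    have hj' : j < N := by omega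
    have hjT := hmemT j hj'.le
    have hj1T := hmemT (j + 1) hj.le
    have e1 : ((j + 1 : ℕ) : ℝ) * τ - j * τ = τ := by push_cast; ring
    have h1 := hz.norm_sub_sub_le hK hzA (fun s hs => hB _ (hzA s hs)) hjT.1
      (by linarith) hj1T.2
    rw [e1] at h1
    have h2 : ‖Z (j + 1) - Z j‖ ≤ τ * B := by
      rw [hZ j hj, add_sub_cancel_left, norm_smul, Real.norm_of_nonneg hτ]
      refine mul_le_mul_of_nonneg_left (max_le ?_ ?_) hτ
      · exact (norm_fst_le (V (Z j))).trans (hB _ (hZA j hj'))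
      · exact (norm_snd_le (V (Z (j + 1)))).trans (hB _ (hZA _ hj))
    have h3 := hK.dist_le_mul _ (hZA j hj') _ (hzA _ hjT)
    have h4 := hK.dist_le_mul _ (hZA _ hj) _ (hZA j hj')
    rw [dist_eq_norm, dist_eq_norm] at h3 h4
    have h5 : ‖((V (Z j)).1, (V (Z (j + 1))).2) - V (z (j * τ))‖ ≤
        K * ‖Z j - z (j * τ)‖ + K * (τ * B) := by
      have h4' : ‖V (Z (j + 1)) - V (Z j)‖ ≤ K * (τ * B) := h4.trans (by gcongr)
      refine max_le ?_ ?_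
      · have := (norm_fst_le (V (Z j) - V (z (j * τ)))).trans h3
        exact this.trans (le_add_of_nonneg_right (by positivity))
      · have e : (V (Z (j + 1))).2 - (V (z (j * τ))).2 =
            (V (Z j) - V (z (j * τ))).2 + (V (Z (j + 1)) - V (Z j)).2 := by
          simp only [Prod.snd_sub]; abel
        refine (congrArg norm e).trans_le ((norm_add_le _ _).trans ?_)
        exact add_le_add ((norm_snd_le _).trans h3) ((norm_snd_le _).trans h4')
    have e2 : Z (j + 1) - z ((j + 1 : ℕ) * τ) = (Z j - z (j * τ)) +
        τ • (((V (Z j)).1, (V (Z (j + 1))).2) - V (z (j * τ))) -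
        (z ((j + 1 : ℕ) * τ) - z (j * τ) - τ • V (z (j * τ))) := by
      conv_lhs => rw [hZ j hj]
      module
    have h6 : ‖τ • (((V (Z j)).1, (V (Z (j + 1))).2) - V (z (j * τ)))‖ ≤
        τ * (K * ‖Z j - z (j * τ)‖ + K * (τ * B)) := by
      rw [norm_smul, Real.norm_of_nonneg hτ]
      exact mul_le_mul_of_nonneg_left h5 hτ
    rw [e2]
    refine (norm_sub_le _ _).trans ?_
    have h7 := norm_add_le (Z j - z (j * τ))
      (τ • (((V (Z j)).1, (V (Z (j + 1))).2) - V (z (j * τ))))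
    linarith
  let u : ℕ → ℝ := fun j => if j < N then ‖Z j - z (j * τ)‖ else 0
  have hu0 : ∀ j, 0 ≤ u j := fun j => by
    simp only [u]; split_ifs
    · exact norm_nonneg _
    · exact le_rfl
  have hb0 : 0 ≤ 2 * K * B * τ ^ 2 := by positivity
  have hu : ∀ j ≥ 0, u (j + 1) ≤ (1 + K * τ) * u j + 2 * K * B * τ ^ 2 := fun j _ => by
    by_cases hj : j + 1 < N
    · simp only [u, if_pos hj, if_pos (show j < N by omega)]
      exact hstep j hj
    · have : u (j + 1) = 0 := if_neg hj
      rw [this]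
      have := hu0 j
      positivity
  have hfin := discrete_gronwall (hu0 0) hu (fun _ _ => by positivity) (fun _ _ => hb0)
    (Nat.zero_le k)
  have hkN : (k : ℝ) * τ ≤ T := (hmemT k hk.le).2
  simp only [Finset.sum_const, Nat.card_Ico, tsub_zero, nsmul_eq_mul, u, if_pos hk,
    if_pos (show 0 < N by omega), Nat.cast_zero, zero_mul] at hfin
  refine hfin.trans ?_
  have e3 : (k : ℝ) * (2 * K * B * τ ^ 2) = k * τ * (2 * K * B * τ) := by ring
  have e4 : (k : ℝ) * (K * τ) = K * (k * τ) := by ring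
  rw [e3, e4]
  gcongr

end Euler

/-! ### Existence of minimising bicharacteristics -/

/-- `γ` is admissible on `[0, t]`: its velocity lies in `c(γ) W`, expressed through the support
function. -/
def IsAdmissible (c Φ : E d → ℝ) (t : ℝ) (γ : ℝ → E d) : Prop :=
  ∀ s ∈ Icc 0 t, ∃ a : E d, (∀ u, inner ℝ u a ≤ c (γ s) * Φ u) ∧ HasDerivWithinAt γ a (Icc 0 t) s

/-- Sampled finely enough, an admissible curve has discrete speed at most `κ`, for any `κ > 1`. -/
theorem IsAdmissible.exists_sampling (h : IsWulffBody Φ W) (hc : Continuous c) {c₀ : ℝ}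
    (hc₀ : 0 < c₀) (hcbd : ∀ x, c₀ ≤ c x) {t κ : ℝ} (ht : 0 < t) (hκ : 1 < κ) {γ : ℝ → E d}
    (hγ : IsAdmissible c Φ t γ) (n : ℕ) :
    ∃ N : ℕ, n < N ∧ ∃ Y : ℕ → E d, Y 0 = γ 0 ∧ (∀ k, N ≤ k → Y k = γ t) ∧
      ∀ k < N, gauge W (Y (k + 1) - Y k) ≤ t / N * κ * c (Y k) := by
  have hcont : ContinuousOn γ (Icc 0 t) := fun s hs => by
    obtain ⟨a, -, ha⟩ := hγ s hs
    exact ha.continuousWithinAt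
  have huc : UniformContinuousOn (fun s => c (γ s)) (Icc 0 t) :=
    isCompact_Icc.uniformContinuousOn_of_continuous (hc.comp_continuousOn hcont)
  obtain ⟨δ, hδ, hunif⟩ := Metric.uniformContinuousOn_iff.1 huc ((κ - 1) * c₀)
    (mul_pos (by linarith) hc₀)
  obtain ⟨N₁, hN₁⟩ := exists_nat_gt (t / δ)
  have hNpos : (0 : ℝ) < (max N₁ (n + 1) : ℕ) := by positivity
  refine ⟨max N₁ (n + 1), by omega, fun k => γ (min (k * (t / (max N₁ (n + 1) : ℕ))) t),
    by simp [ht.le], fun k hk => ?_, fun k hk => ?_⟩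
  · have : t ≤ k * (t / (max N₁ (n + 1) : ℕ)) := by
      rw [← mul_div_assoc, le_div_iff₀ hNpos, mul_comm]
      exact mul_le_mul_of_nonneg_right (by exact_mod_cast hk) ht.le
    simp only [min_eq_right this]
  set N : ℕ := max N₁ (n + 1)
  set τ : ℝ := t / N with hτdef
  have hτ : 0 < τ := div_pos ht hNpos
  have hτδ : τ < δ := by
    rw [hτdef, div_lt_iff₀ hNpos, mul_comm, ← div_lt_iff₀ hδ]
    exact hN₁.trans_le (by exact_mod_cast le_max_left _ _)
  have hNτ : N * τ = t := mul_div_cancel₀ _ hNpos.ne'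
  have hk1 : ((k : ℝ) + 1) * τ ≤ t := by
    rw [← hNτ]
    exact mul_le_mul_of_nonneg_right (by exact_mod_cast hk) hτ.le
  have hk0 : 0 ≤ (k : ℝ) * τ := by positivity
  have hlt : (k : ℝ) * τ < (k + 1) * τ := by linarith
  have hkt : (k : ℝ) * τ ≤ t := hlt.le.trans hk1
  push_cast
  rw [min_eq_left hk1, min_eq_left hkt]
  have hck : 0 < c (γ (k * τ)) := hc₀.trans_le (hcbd _)
  refine h.gauge_le_of_forall_inner_le (by positivity) fun q => ?_
  choose! a ha using hγ
  obtain ⟨s, hs, hslope⟩ := exists_hasDerivAt_eq_slope (fun s => inner ℝ q (γ s))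
    (fun s => inner ℝ q (a s)) hlt
    ((continuous_const.inner continuous_id).comp_continuousOn
      (hcont.mono (Icc_subset_Icc hk0 hk1))) fun s hs => by
        have hsT : s ∈ Icc 0 t := ⟨hk0.trans hs.1.le, hs.2.le.trans hk1⟩
        have h1 := (ha s hsT).2.hasDerivAt (Icc_mem_nhds (hk0.trans_lt hs.1) (hs.2.trans_le hk1))
        exact (innerSL ℝ q).hasFDerivAt.comp_hasDerivAt s h1
  have hsT : s ∈ Icc 0 t := ⟨hk0.trans hs.1.le, hs.2.le.trans hk1⟩
  have h1 := (ha s hsT).1 q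
  have h2 : c (γ s) ≤ κ * c (γ (k * τ)) := by
    have h3 := hunif s hsT (k * τ) ⟨hk0, hkt⟩ (by
      rw [Real.dist_eq, abs_of_pos (by linarith [hs.1])]
      linarith [hs.2])
    have h4 := (abs_lt.1 (Real.dist_eq _ _ ▸ h3)).2
    have h5 := mul_le_mul_of_nonneg_left (hcbd (γ (k * τ))) (show 0 ≤ κ - 1 by linarith)
    linarith
  have e : ((k : ℝ) + 1) * τ - k * τ = τ := by ring
  rw [e, eq_div_iff hτ.ne'] at hslope
  rw [inner_sub_right, ← hslope]
  calc inner ℝ q (a s) * τ ≤ κ * c (γ (k * τ)) * Φ q * τ := by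
        refine mul_le_mul_of_nonneg_right (h1.trans ?_) hτ.le
        exact mul_le_mul_of_nonneg_right h2 (h.apply_nonneg q)
    _ = _ := by ring

/-- The momenta of a discrete extremal are bounded: some momentum is bounded by the mean energy, and
the total variation of the momentum is controlled by the total energy. -/
theorem norm_momentum_le {c₀ m D : ℝ} (hc₀ : 0 < c₀) (hcbd : ∀ x, c₀ ≤ c x)
    (hm : 0 < m) (hb : ∀ p, m * ‖p‖ ≤ Φ p) {N : ℕ} {τ κ : ℝ} (hτ : 0 < τ)
    {X P : ℕ → E d} (hD : ∀ k ≤ N, ‖gradient c (X k)‖ ≤ D)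
    (hP : ∀ k, k + 1 < N → P k =
        P (k + 1) + τ • (c (X (k + 1)) * Φ (P (k + 1)) ^ 2) • gradient c (X (k + 1)))
    {k₀ : ℕ} (hk₀ : k₀ < N) (hk₀e : c (X k₀) * Φ (P k₀) ≤ κ)
    (hE : ∑ k ∈ Finset.range N, (c (X k) * Φ (P k)) ^ 2 ≤ N * κ ^ 2) :
    ∀ k < N, ‖P k‖ ≤ κ / (c₀ * m) + D / c₀ * (N * τ) * κ ^ 2 := by
  have hpos : ∀ x, 0 < c x := fun x => hc₀.trans_le (hcbd x)
  have hD0 : 0 ≤ D := (norm_nonneg _).trans (hD 0 (Nat.zero_le _))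
  have hstep : ∀ k, k + 1 < N →
      dist (P k) (P (k + 1)) ≤ τ * D / c₀ * (c (X (k + 1)) * Φ (P (k + 1))) ^ 2 := fun k hk => by
    have hck := hpos (X (k + 1))
    rw [dist_eq_norm, hP k hk, add_sub_cancel_left, norm_smul, norm_smul,
      Real.norm_of_nonneg hτ.le, Real.norm_of_nonneg (by positivity)]
    have h1 : c (X (k + 1)) * Φ (P (k + 1)) ^ 2 ≤ (c (X (k + 1)) * Φ (P (k + 1))) ^ 2 / c₀ := by
      rw [le_div_iff₀ hc₀]
      calc c (X (k + 1)) * Φ (P (k + 1)) ^ 2 * c₀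
          ≤ c (X (k + 1)) * Φ (P (k + 1)) ^ 2 * c (X (k + 1)) := by
            gcongr; exact hcbd _
        _ = _ := by ring
    calc τ * (c (X (k + 1)) * Φ (P (k + 1)) ^ 2 * ‖gradient c (X (k + 1))‖)
        ≤ τ * ((c (X (k + 1)) * Φ (P (k + 1))) ^ 2 / c₀ * D) := by
          gcongr; exact hD _ hk.le
      _ = _ := by ring
  have hvar : ∀ i j, i ≤ j → j < N → dist (P i) (P j) ≤ D / c₀ * (N * τ) * κ ^ 2 :=
    fun i j hij hj => by
      calc dist (P i) (P j)
          ≤ ∑ k ∈ Finset.Ico i j, τ * D / c₀ * (c (X (k + 1)) * Φ (P (k + 1))) ^ 2 :=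
            dist_le_Ico_sum_of_dist_le hij fun {k} hk1 hk2 => hstep k (by omega)
        _ = τ * D / c₀ * ∑ k ∈ Finset.Ico (i + 1) (j + 1), (c (X k) * Φ (P k)) ^ 2 := by
            rw [← Finset.mul_sum, Finset.sum_Ico_add' (fun k => (c (X k) * Φ (P k)) ^ 2)]
        _ ≤ τ * D / c₀ * ∑ k ∈ Finset.range N, (c (X k) * Φ (P k)) ^ 2 := by
            gcongr
            intro k hk
            rw [Finset.mem_Ico] at hk
            exact Finset.mem_range.2 (by omega)
        _ ≤ τ * D / c₀ * (N * κ ^ 2) := by gcongr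
        _ = _ := by ring
  intro k hk
  have h1 : ‖P k₀‖ ≤ κ / (c₀ * m) := by
    rw [le_div_iff₀ (by positivity)]
    calc ‖P k₀‖ * (c₀ * m) = c₀ * (m * ‖P k₀‖) := by ring
      _ ≤ c (X k₀) * Φ (P k₀) := mul_le_mul (hcbd _) (hb _) (by positivity) (hpos _).le
      _ ≤ κ := hk₀e
  have h2 : dist (P k) (P k₀) ≤ D / c₀ * (N * τ) * κ ^ 2 := by
    rcases le_total k k₀ with hkk | hkk
    · exact hvar k k₀ hkk hk₀
    · rw [dist_comm]
      exact hvar k₀ k hkk hk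
  rw [dist_eq_norm] at h2
  linarith [norm_sub_norm_le (P k) (P k₀)]

/-- The endpoints of an admissible curve are joined, in the same time, by a trajectory of the squared
Hamiltonian of energy at most one: a limit of minimisers of the discrete action. -/
theorem IsAdmissible.exists_isSolution (h : IsWulffBody Φ W) (hc : ContDiff ℝ ∞ c) {c₀ C₀ : ℝ}
    (hc₀ : 0 < c₀) (hcbd : ∀ x, c₀ ≤ c x ∧ c x ≤ C₀) {t : ℝ} (ht : 0 < t) {γ : ℝ → E d}
    (hγ : IsAdmissible c Φ t γ) :
    ∃ z, IsSolution (squaredField c Φ) t z ∧ (z 0).1 = γ 0 ∧ (z t).1 = γ t ∧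
      c (z 0).1 * Φ (z 0).2 ≤ 1 := by
  have hpos : ∀ x, 0 < c x := fun x => hc₀.trans_le (hcbd x).1
  have hC₀ : 0 < C₀ := (hpos 0).trans_le (hcbd 0).2
  obtain ⟨ρ, hρ0, hρ⟩ := h.exists_norm_le
  obtain ⟨m, M, hm, -, hb⟩ := h.exists_bounds
  set x := γ t
  set y := γ 0
  -- discrete extremals of mean speed at most `κ n`, which tends to one
  let κ : ℕ → ℝ := fun n => 1 + 1 / ((n : ℝ) + 1)
  have hκ1 : ∀ n, 1 < κ n := fun n => by
    have : 0 < 1 / ((n : ℝ) + 1) := by positivity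
    simp only [κ]; linarith
  have hκ0 : ∀ n, 0 ≤ κ n := fun n => by linarith [hκ1 n]
  have hκ2 : ∀ n, κ n ≤ 2 := fun n => by
    have : 1 / ((n : ℝ) + 1) ≤ 1 := by
      rw [div_le_one (by positivity)]
      linarith [(Nat.cast_nonneg n : (0 : ℝ) ≤ n)]
    simp only [κ]; linarith
  have hκlim : Tendsto κ atTop (𝓝 1) := by
    simpa [κ] using (tendsto_one_div_add_atTop_nhds_zero_nat (𝕜 := ℝ)).const_add (1 : ℝ)
  choose N hNn Y hY0 hYN hY using fun n =>
    hγ.exists_sampling h hc.continuous hc₀ (fun x => (hcbd x).1) ht (hκ1 n) n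
  let τ : ℕ → ℝ := fun n => t / N n
  have hNpos : ∀ n, 0 < N n := fun n => (Nat.zero_le n).trans_lt (hNn n)
  have hNpos' : ∀ n, (0 : ℝ) < N n := fun n => by exact_mod_cast hNpos n
  have hτ : ∀ n, 0 < τ n := fun n => div_pos ht (hNpos' n)
  have hNτ : ∀ n, N n * τ n = t := fun n => mul_div_cancel₀ _ (hNpos' n).ne'
  have hτlim : Tendsto τ atTop (𝓝 0) := by
    have hlim : Tendsto (fun n => (N n : ℝ)) atTop atTop :=
      tendsto_natCast_atTop_atTop.comp (tendsto_atTop_mono (fun n => (hNn n).le) tendsto_id)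
    exact hlim.const_div_atTop t
  choose X P hX0 hXN hXstep hPstep hE hXb using fun n =>
    exists_symplecticEuler h hc hpos (fun x => (hcbd x).2) hρ0.le hρ (hNpos n) (hτ n) (hκ0 n)
      (hY0 n) (hYN n) (hY n)
  have hXb' : ∀ n, ∀ k ≤ N n, ‖X n k - y‖ ≤ ρ * (C₀ * (t * 2)) := fun n k hk => by
    refine (hXb n k hk).trans ?_
    rw [← mul_assoc (N n : ℝ), hNτ]
    gcongr
    exact hκ2 n
  have hlow : ∀ n, ∃ k < N n, c (X n k) * Φ (P n k) ≤ κ n := fun n => by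
    have hsum : ∑ k ∈ Finset.range (N n), (c (X n k) * Φ (P n k)) ^ 2 ≤
        ∑ k ∈ Finset.range (N n), κ n ^ 2 := by simpa using hE n
    obtain ⟨k, hk, hle⟩ := Finset.exists_le_of_sum_le
      (Finset.nonempty_range_iff.2 (hNpos n).ne') hsum
    exact ⟨k, Finset.mem_range.1 hk, (abs_le_of_sq_le_sq' hle (hκ0 n)).2⟩
  choose k₀ hk₀ hk₀e using hlow
  obtain ⟨D, hD⟩ := (isCompact_closedBall y (ρ * (C₀ * (t * 2)))).exists_bound_of_continuousOn
    (contDiff_gradient hc).continuous.continuousOn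
  have hD' : ∀ n, ∀ k ≤ N n, ‖gradient c (X n k)‖ ≤ D := fun n k hk =>
    hD _ (by rw [mem_closedBall_iff_norm]; exact hXb' n k hk)
  have hD0 : 0 ≤ D := (norm_nonneg _).trans (hD' 0 0 (Nat.zero_le _))
  set S : ℝ := 2 / (c₀ * m) + D / c₀ * t * 2 ^ 2 with hS
  have hPb : ∀ n, ∀ k < N n, ‖P n k‖ ≤ S := fun n k hk => by
    have h1 := norm_momentum_le hc₀ (fun x => (hcbd x).1) hm (fun p => (hb p).1) (hτ n) (hD' n)
      (hPstep n) (hk₀ n) (hk₀e n) (hE n) k hk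
    rw [hNτ] at h1
    have := hκ0 n
    have := hκ2 n
    refine h1.trans ?_
    rw [hS]
    gcongr
  -- a limit of the initial momenta, and the exact trajectory it generates
  obtain ⟨p₀, -, φ, hφ, hlim⟩ := (isCompact_closedBall (0 : E d) S).tendsto_subseq
    (x := fun n => P n 0) fun n => by simpa using hPb n 0 (hNpos n)
  obtain ⟨z, hz0, hz⟩ := exists_isSolution_squaredField h hc hc₀ hcbd ht.le (y, p₀)
  obtain ⟨R₁, hR₁⟩ := isCompact_Icc.exists_bound_of_continuousOn hz.continuousOn
  set R : ℝ := max R₁ (max (‖y‖ + ρ * (C₀ * (t * 2))) S) with hR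
  set A : Set (E d × E d) := Metric.closedBall 0 R with hA
  have hAc : IsCompact A := isCompact_closedBall _ _
  have hV := locallyLipschitz_squaredField h hc
  obtain ⟨K, hK⟩ := (hV.locallyLipschitzOn (s := A)).exists_lipschitzOnWith_of_compact hAc
  obtain ⟨B, hB⟩ := hAc.exists_bound_of_continuousOn hV.continuous.continuousOn
  have hen : LocallyLipschitz fun w : E d × E d => c w.1 * Φ w.2 := by
    have h1 : LocallyLipschitz fun w : E d × E d => c w.1 :=
      (hc.of_le (by exact_mod_cast le_top)).locallyLipschitz.comp
        LipschitzWith.prod_fst.locallyLipschitz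
    have h2 : LocallyLipschitz fun w : E d × E d => Φ w.2 :=
      h.convexOn.locallyLipschitz.comp LipschitzWith.prod_snd.locallyLipschitz
    exact (contDiff_fst.mul contDiff_snd :
      ContDiff ℝ 1 fun q : ℝ × ℝ => q.1 * q.2).locallyLipschitz.comp (h1.prodMk h2)
  obtain ⟨K', hK'⟩ := (hen.locallyLipschitzOn (s := A)).exists_lipschitzOnWith_of_compact hAc
  have hzA : ∀ s ∈ Icc 0 t, z s ∈ A := fun s hs => by
    rw [hA, mem_closedBall_zero_iff]
    exact (hR₁ s hs).trans (le_max_left _ _)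
  have hZA : ∀ n, ∀ k < N n, (X n k, P n k) ∈ A := fun n k hk => by
    rw [hA, mem_closedBall_zero_iff]
    refine max_le ?_ ?_
    · have h1 := hXb' n k hk.le
      have h2 := norm_sub_norm_le (X n k) y
      exact le_trans (by linarith) ((le_max_left _ _).trans (le_max_right _ _))
    · exact (hPb n k hk).trans ((le_max_right _ _).trans (le_max_right _ _))
  have hB0 : 0 ≤ B := (norm_nonneg _).trans (hB _ (hZA 0 0 (hNpos 0)))
  let η : ℕ → ℝ := fun n => (‖P n 0 - p₀‖ + t * (2 * K * B * τ n)) * Real.exp (K * t)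
  have herr : ∀ n, ∀ k < N n, ‖(X n k, P n k) - z (k * τ n)‖ ≤ η n := fun n k hk => by
    have h1 := norm_sub_le_of_symplecticEuler hz hK hzA hB (hτ n).le (hNτ n)
      (Z := fun k => (X n k, P n k)) (hZA n) (fun k hk => by
        have e := hPstep n k hk
        refine Prod.ext (hXstep n k (by omega)) ?_
        simp only [squaredField, Prod.snd_add, Prod.smul_snd, smul_neg]
        rw [e]; abel) k hk
    rw [hz0] at h1
    have h2 : ‖(X n 0, P n 0) - (y, p₀)‖ = ‖P n 0 - p₀‖ := by
      rw [hX0, Prod.mk_sub_mk, sub_self, Prod.norm_def]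
      simp
    simp only [h2] at h1
    exact h1
  have hηlim : Tendsto (η ∘ φ) atTop (𝓝 0) := by
    have h1 : Tendsto (fun n => ‖P (φ n) 0 - p₀‖) atTop (𝓝 0) := by
      simpa using (hlim.sub_const p₀).norm
    have h2 := hτlim.comp hφ.tendsto_atTop
    have h3 := (h1.add ((h2.const_mul (2 * K * B)).const_mul t)).mul_const (Real.exp (K * t))
    simpa [η, Function.comp_def] using h3
  refine ⟨z, hz, by rw [hz0], ?_, ?_⟩
  · -- the last vertex is at distance `O(η + τ)` from the endpoint of the trajectory
    have hend : ∀ n, ‖(z t).1 - x‖ ≤ η n + 2 * B * τ n := fun n => by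
      obtain ⟨k, hk⟩ : ∃ k, N n = k + 1 := ⟨N n - 1, by have := hNpos n; omega⟩
      have hkN : k < N n := by omega
      have h1 := (norm_fst_le _).trans (herr n k hkN)
      have h2 : ‖X n (k + 1) - X n k‖ ≤ B * τ n := by
        rw [hXstep n k hkN, add_sub_cancel_left, norm_smul, Real.norm_of_nonneg (hτ n).le, mul_comm]
        exact mul_le_mul_of_nonneg_right
          ((norm_fst_le (squaredField c Φ (X n k, P n k))).trans (hB _ (hZA n k hkN))) (hτ n).le
      have hkt : (k : ℝ) * τ n = t - τ n := by
        have := hNτ n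
        rw [hk] at this
        push_cast at this
        linarith
      have hk0 : 0 ≤ t - τ n := hkt ▸ mul_nonneg (Nat.cast_nonneg _) (hτ n).le
      have h3 := (norm_fst_le _).trans (hz.norm_sub_le (fun s hs => hB _ (hzA s hs)) hk0
        (by linarith [hτ n]) le_rfl)
      rw [sub_sub_cancel] at h3
      rw [hkt] at h1
      have hxN : X n (k + 1) = x := by rw [← hk, hXN]
      have e : (z t).1 - x = (z t - z (t - τ n)).1 - ((X n k, P n k) - z (t - τ n)).1 -
          (X n (k + 1) - X n k) := by
        rw [hxN]; simp only [Prod.fst_sub]; abel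
      rw [e]
      have h4 := norm_sub_le ((z t - z (t - τ n)).1 - ((X n k, P n k) - z (t - τ n)).1)
        (X n (k + 1) - X n k)
      have h5 := norm_sub_le (z t - z (t - τ n)).1 ((X n k, P n k) - z (t - τ n)).1
      linarith
    have hlim0 : Tendsto (fun n => η (φ n) + 2 * B * τ (φ n)) atTop (𝓝 0) := by
      simpa using hηlim.add ((hτlim.comp hφ.tendsto_atTop).const_mul (2 * B))
    exact sub_eq_zero.1 (norm_le_zero_iff.1 (ge_of_tendsto' hlim0 fun n => hend (φ n)))
  · have hle : ∀ n, c (z 0).1 * Φ (z 0).2 ≤ κ n + K' * η n := fun n => by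
      have hkt : (k₀ n : ℝ) * τ n ∈ Icc 0 t := ⟨mul_nonneg (Nat.cast_nonneg _) (hτ n).le, by
        rw [← hNτ n]
        exact mul_le_mul_of_nonneg_right (by exact_mod_cast (hk₀ n).le) (hτ n).le⟩
      rw [← IsSolution.energy_eq h hc hpos hz _ hkt]
      have h1 := hK'.dist_le_mul _ (hZA n _ (hk₀ n)) _ (hzA _ hkt)
      rw [Real.dist_eq, dist_eq_norm] at h1
      have h2 := (abs_le.1 h1).1
      have h3 := mul_le_mul_of_nonneg_left (herr n _ (hk₀ n)) K'.2
      have h4 := hk₀e n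
      simp only [NNReal.val_eq_coe] at h3
      linarith
    have hlim1 : Tendsto (fun n => κ (φ n) + K' * η (φ n)) atTop (𝓝 1) := by
      simpa using (hκlim.comp hφ.tendsto_atTop).add (hηlim.const_mul (K' : ℝ))
    exact ge_of_tendsto' hlim1 fun n => hle (φ n)

/-- Solutions of the inclusion system are admissible curves whatever their momentum is, so their
endpoints are joined by a bicharacteristic taking no more time. -/
theorem setC_subset_setB (h : IsWulffBody Φ W) (hd : 1 ≤ d) (hc : ContDiff ℝ ∞ c) {c₀ C₀ : ℝ}
    (hc₀ : 0 < c₀) (hcbd : ∀ x, c₀ ≤ c x ∧ c x ≤ C₀) (x : E d) {t : ℝ} (ht : 0 < t) :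
    setC (hamiltonian c Φ) x t ⊆ setB (hamiltonian c Φ) x t := by
  have hpos : ∀ x, 0 < c x := fun x => hc₀.trans_le (hcbd x).1
  intro y hy
  obtain ⟨v, γ, p, -, -, hb, hx, -, rfl⟩ := mem_iUnion.1 hy
  have hγ : IsAdmissible c Φ t γ := fun s hs => by
    obtain ⟨a, b, ha, -, hd, -⟩ := hb s hs
    exact ⟨a, inner_le_of_mem_mordukhovichSubdifferential h (hpos _) ha, hd⟩
  obtain ⟨z, hz, hz0, hzt, hle⟩ := hγ.exists_isSolution h hc hc₀ hcbd ht
  rw [hx] at hzt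
  set l := c (z 0).1 * Φ (z 0).2 with hl
  have hl0 : 0 ≤ l := mul_nonneg (hpos _).le (h.apply_nonneg _)
  have htmem : t ∈ Icc 0 t := ⟨ht.le, le_rfl⟩
  simp only [setB, mem_iUnion]
  rcases hl0.eq_or_lt with hl0 | hl0
  · -- at zero energy the trajectory is constant, and a bicharacteristic of length zero will do
    have hzero : ∀ s ∈ Icc 0 t, Φ (z s).2 = 0 := fun s hs => by
      have := IsSolution.energy_eq h hc hpos hz s hs
      rw [← hl, ← hl0] at this
      exact (mul_eq_zero.1 this).resolve_left (hpos _).ne'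
    have hconst : z t = z 0 := by
      have := hz.norm_sub_le (B := 0) (fun s hs => by
        have h2 : (z s).2 = 0 := h.apply_eq_zero.1 (hzero s hs)
        simp [squaredField, h2, h.legendreMap_zero, h.apply_zero]) le_rfl ht.le le_rfl
      rw [zero_mul] at this
      exact sub_eq_zero.1 (norm_le_zero_iff.1 this)
    have hxy : γ 0 = x := by rw [← hz0, ← hzt, hconst]
    have : Nonempty (Fin d) := ⟨⟨0, hd⟩⟩
    obtain ⟨e, he⟩ := exists_ne (0 : E d)
    obtain ⟨γ', p', hb', hx', hp'⟩ :=
      (setBWellDefined h hd hc hc₀ hcbd x t 0 ⟨le_rfl, ht.le⟩ e he).1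
    exact ⟨0, ⟨le_rfl, ht.le⟩, e, he, γ', p', hb', hx', hp', hx'.trans hxy.symm⟩
  · have hb' := hz.isBicharacteristic h hc hpos hl0 hl.symm
    have e : l⁻¹ * (l * t) = t := inv_mul_cancel_left₀ hl0.ne' t
    refine ⟨l * t, ⟨by positivity, by nlinarith⟩, (z t).2, ?_, _, _, hb', ?_, ?_, ?_⟩
    · intro h0
      have := IsSolution.energy_eq h hc hpos hz t htmem
      rw [h0, h.apply_zero, mul_zero] at this
      exact hl0.ne this
    · simp only [e, hzt]
    · simp only [e]
    · simp only [mul_zero, hz0]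

end HJ

theorem mainTheorem3 (d : ℕ) (hd : 1 ≤ d)
    (c Φ : HJ.E d → ℝ) (W : Set (HJ.E d))
    (hc : ContDiff ℝ ∞ c)
    (c₀ C₀ : ℝ) (hc₀ : 0 < c₀) (hcbd : ∀ x, c₀ ≤ c x ∧ c x ≤ C₀)
    (hΦ : ∀ τ : ℝ, 0 < τ → ∀ p, Φ (τ • p) = τ * Φ p)
    (hΦW : HJ.IsWulffSet Φ W)
    (hWclosed : IsClosed W) (hWconvex : StrictConvex ℝ W)
    (hWbalanced : -W = W) (hWabsorbing : HJ.IsAbsorbing W)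
    (hWsmooth : HJ.HasSmoothPositivelyCurvedBoundary W)
    (hcomplete : HJ.IsCompleteDist (HJ.opticalDist c W))
    (x : HJ.E d) (t : ℝ) (ht : 0 < t) :
    HJ.SetBWellDefined (HJ.hamiltonian c Φ) x t ∧
      HJ.setC (HJ.hamiltonian c Φ) x t = HJ.setB (HJ.hamiltonian c Φ) x t := by
  have h : HJ.IsWulffBody Φ W :=
    ⟨hΦW, hWclosed, hWconvex.convex, hWbalanced, hWabsorbing, hWsmooth⟩
  exact ⟨HJ.setBWellDefined h hd hc hc₀ hcbd x t,
    (HJ.setC_subset_setB h hd hc hc₀ hcbd x ht).antisymm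
      (HJ.setB_subset_setC h hd hc (fun x => hc₀.trans_le (hcbd x).1) x ht)⟩
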